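/- **Conventions.** Work with diffeological spaces and smooth maps; subsets carry the subspace diffeology and products the product diffeology. Let $I=[0,1]$, and let $I^n\subset\mathbf R^n$ be the cube and $\partial I^n$ its boundary. Homotopies are smooth maps $H\colon X\times I\to Y$. A homotopy between maps of pairs $(X,A)\to(Y,B)$ is in addition required to satisfy $H(A\times I)\subset B$. A smooth map of pairs $\phi\colon(X,A)\to(Y,B)$ is a *smooth homotopy equivalence* if there is a smooth map of pairs $\psi\colon(Y,B)\to(X,A)$ such that $\psi\circ\phi$ and $\phi\circ\psi$ are homotopic, as maps of pairs, to the identities. A *smooth CW complex* is a diffeological space $X$ with skeleta $\emptyset=X^{-1}\subset X^0\subset X^1\subset\cdots$ such that $X=\operatorname{colim}X^n$ as a diffeological space and, for each $n\ge 0$, $X^n$ is the pushout, in diffeological spaces, of $\coprod_{\lambda\in\Lambda_n}I^n\supset\coprod_{\lambda\in\Lambda_n}\partial I^n\to X^{n-1}$ along smooth attaching maps $\phi_\lambda\colon\partial I^n\to X^{n-1}$. The induced maps $\Phi_\lambda\colon I^n\to X^n$ are the characteristic maps. The complex has *dimension less than* $N$ if $X=X^{N-1}$. A map $f\colon\partial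 I^n\to Z$ is *tame* if there is $0<\epsilon\le 1/2$ such that $f(t_1,\dots,t_j,\dots,t_n)=f(t_1,\dots,\alpha,\dots,t_n)$ (with $\alpha$ in the $j$-th place) whenever $\alpha\in\{0,1\}$ and $|t_j-\alpha|\le\epsilon$. A smooth CW complex is *gathered* if all its attaching maps are tame. A *subcomplex* of $X$ is a subspace $A$ that is a smooth CW complex all of whose characteristic maps are characteristic maps of $X$. A *pair of gathered CW complexes* $(X,A)$ is a gathered CW complex $X$ with a subcomplex $A$; it has dimension less than $N$ if $X$ has. Let $\pi_n(X,x)=[I^n,\partial I^n;X,x]$ be the set of homotopy classes of smooth maps of pairs, $n\ge 0$. A smooth map $\phi\colon X\to Y$ is an *$N$-equivalence* ($N\ge 0$) if $\phi_*\colon\pi_n(X,x)\to\pi_n(Y,\phi(x))$ is injective and surjective for all $x\in X$ and $0\le n<N$ and, when $N>0$, every point of $Y$ can be joined by a smooth path to a point of $\phi(X)$ (the last condition matters only if $X=\emptyset$). A smooth map of pairs $(X,A)\to(Y,B)$ is an $N$-equivalence if both $X\to Y$ and its restriction $A\to B$ are. A *weak homotopy equivalence* (of spaces or of pairs) is a map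 that is an $N$-equivalence for all $N$. **Theorem (The Whitehead theorem).** Let $(X,A)$ and $(Y,B)$ be pairs of gathered CW complexes, and let $\phi\colon(X,A)\to(Y,B)$ be a smooth map of pairs. 1. If $X$ and $Y$ have dimension less than $N$ and $\phi$ is an $N$-equivalence of pairs, then $\phi$ is a smooth homotopy equivalence of pairs. 2. If $\phi$ is a weak homotopy equivalence of pairs (with no restriction on the dimensions), then $\phi$ is a smooth homotopy equivalence of pairs. 3. In particular, a weak homotopy equivalence $X\to Y$ between gathered CW complexes is a smooth homotopy equivalence. -/

import Mathlib

open Diffeology Topology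

universe u v w w'

/-! ### Subspaces and products of diffeological spaces -/

/-- The subspace diffeology: a map into a subspace is a plot iff it is a plot of the ambient
space. -/
instance Subtype.instDiffeologicalSpace {X : Type u} [DiffeologicalSpace X] {s : X → Prop} :
    DiffeologicalSpace (Subtype s) where
  plots n := {p | IsPlot (fun r : EuclideanSpace ℝ (Fin n) => (p r : X))}
  constant_plots _ := isPlot_const
  plot_reparam {_ _ p _} hp hf := isPlot_reparam (p := fun r => (p r : X)) hp hf
  locality hp := DiffeologicalSpace.locality fun x => by
    obtain ⟨U, hU, hx, h⟩ := hp x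
    exact ⟨U, hU, hx, fun hf hs => h hf hs⟩

/-- The product diffeology: a map into a product is a plot iff both components are plots. -/
instance Prod.instDiffeologicalSpace {X : Type u} {Y : Type v} [DiffeologicalSpace X]
    [DiffeologicalSpace Y] : DiffeologicalSpace (X × Y) where
  plots n := {p | IsPlot (fun r : EuclideanSpace ℝ (Fin n) => (p r).1) ∧
    IsPlot (fun r : EuclideanSpace ℝ (Fin n) => (p r).2)}
  constant_plots _ := ⟨isPlot_const, isPlot_const⟩
  plot_reparam {_ _ p _} hp hf := ⟨isPlot_reparam (p := fun r => (p r).1) hp.1 hf,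
    isPlot_reparam (p := fun r => (p r).2) hp.2 hf⟩
  locality hp := by
    refine ⟨DiffeologicalSpace.locality fun x => ?_, DiffeologicalSpace.locality fun x => ?_⟩
    · obtain ⟨U, hU, hx, h⟩ := hp x
      exact ⟨U, hU, hx, fun hf hs => (h hf hs).1⟩
    · obtain ⟨U, hU, hx, h⟩ := hp x
      exact ⟨U, hU, hx, fun hf hs => (h hf hs).2⟩

namespace SmoothCW

/-! ### Cubes and tame maps -/

/-- The cube `I ^ n`, as a subspace of the Euclidean space `ℝ ^ n`. -/
def cube (n : ℕ) : Set (EuclideanSpace ℝ (Fin n)) :=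
  {t | ∀ j, t j ∈ Set.Icc (0 : ℝ) 1}

/-- The boundary `∂ I ^ n` of the cube; it is empty for `n = 0`. -/
def cubeBoundary (n : ℕ) : Set (cube n) :=
  {t | ∃ j, t.1 j = 0 ∨ t.1 j = 1}

/-- A map `f : K → X` on a subset `K` of `I ^ n` is tame if, for some `0 < ε ≤ 1 / 2`, its value
does not change when a coordinate lying within `ε` of `α ∈ {0, 1}` is replaced by `α`. -/
def IsTame {n : ℕ} {K : Set (cube n)} {X : Type u} (f : K → X) : Prop :=
  ∃ ε : ℝ, 0 < ε ∧ ε ≤ 1 / 2 ∧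
    ∀ (s t : K) (j : Fin n) (α : ℝ), (α = 0 ∨ α = 1) → |s.1.1 j - α| ≤ ε →
      t.1.1 j = α → (∀ k, k ≠ j → t.1.1 k = s.1.1 k) → f s = f t

/-! ### Smooth CW complexes -/

/-- The map `p : ℝ ^ m → Z` agrees near the point `r` with `f ∘ q` for some plot `q` of `E`.
(By precomposing with a smooth map that is the identity near `r`, it makes no difference whether
`q` is required to be a plot on all of `ℝ ^ m` or only on a neighbourhood of `r`.) -/
def LiftsAt {E : Type u} {Z : Type v} [DiffeologicalSpace E] (f : E → Z) {m : ℕ}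
    (p : EuclideanSpace ℝ (Fin m) → Z) (r : EuclideanSpace ℝ (Fin m)) : Prop :=
  ∃ q : EuclideanSpace ℝ (Fin m) → E, IsPlot q ∧ p =ᶠ[𝓝 r] f ∘ q

/-- The square of diffeological spaces
`∐ ∂ I ^ n → B` (given by the attaching maps `att`), `∐ ∂ I ^ n ⊆ ∐ I ^ n`,
`inc : B → P`, `∐ I ^ n → P` (given by the characteristic maps `char`)
is a pushout square: `P` is the quotient of the coproduct of `B` and `∐ I ^ n` by the smallest
equivalence relation that identifies `att l t ∈ B` with `t` in the `l`-th cube for all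
`t ∈ ∂ I ^ n`, and it carries the quotient diffeology, i.e. the final diffeology (whose plots are
the maps that lift locally) with respect to `inc` and all `char l`. -/
structure IsCellPushout {n : ℕ} {Λ : Type w} {B : Type u} {P : Type v} [DiffeologicalSpace B]
    [DiffeologicalSpace P] (inc : B → P) (att : Λ → cubeBoundary n → B)
    (char : Λ → cube n → P) : Prop where
  smooth_att : ∀ l, DSmooth (att l)
  surjective : Function.Surjective
    (Sum.elim inc fun c : Λ × cube n => char c.1 c.2)
  eq_iff : ∀ a b : B ⊕ (Λ × cube n),
    Sum.elim inc (fun c : Λ × cube n => char c.1 c.2) a =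
        Sum.elim inc (fun c : Λ × cube n => char c.1 c.2) b ↔
      Relation.EqvGen
        (fun x y => ∃ (l : Λ) (t : cubeBoundary n), x = Sum.inl (att l t) ∧ y = Sum.inr (l, t.1))
        a b
  isPlot_iff : ∀ {m : ℕ} (p : EuclideanSpace ℝ (Fin m) → P),
    IsPlot p ↔ ∀ r, LiftsAt inc p r ∨ ∃ l, LiftsAt (char l) p r

/-- A smooth relative CW structure on the pair of diffeological spaces `(X, A)`, where `A` is a
subspace of `X`. The set `skel k` is the skeleton `X ^ (k - 1)`, so that `skel 0` is
`X ^ (-1) = A`, and `skel (n + 1)` is `X ^ n`, with the subspace diffeology, arises from `skel n`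
by attaching a family of `n`-cubes. The space `X` is the colimit of the skeleta: it is their union
and carries the final diffeology with respect to their inclusions. -/
structure RelCWComplex (X : Type u) [DiffeologicalSpace X] (A : Set X) where
  skel : ℕ → Set X
  skel_zero : skel 0 = A
  skel_subset : ∀ n, skel n ⊆ skel (n + 1)
  cell : ℕ → Type w
  attachMap : ∀ n, cell n → cubeBoundary n → skel n
  charMap : ∀ n, cell n → cube n → skel (n + 1)
  isPushout : ∀ n, IsCellPushout (Set.inclusion (skel_subset n)) (attachMap n) (charMap n)
  iUnion_skel : ⋃ n, skel n = Set.univ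
  isPlot_iff : ∀ {m : ℕ} (p : EuclideanSpace ℝ (Fin m) → X),
    IsPlot p ↔ ∀ r, ∃ n, LiftsAt (Subtype.val : skel n → X) p r

/-- A smooth CW structure on `X` is a smooth relative CW structure on `(X, ∅)`. -/
abbrev CWComplex (X : Type u) [DiffeologicalSpace X] := RelCWComplex.{u, w} X ∅

/-- A smooth relative CW complex is gathered if all its attaching maps are tame. -/
def RelCWComplex.IsGathered {X : Type u} [DiffeologicalSpace X] {A : Set X}
    (c : RelCWComplex.{u, w} X A) : Prop :=
  ∀ n (l : c.cell n), IsTame (c.attachMap n l)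

/-- The dimension is less than `N`, i.e. `X = X ^ (N - 1)`. -/
def RelCWComplex.DimLT {X : Type u} [DiffeologicalSpace X] {A : Set X}
    (c : RelCWComplex.{u, w} X A) (N : ℕ) : Prop :=
  c.skel N = Set.univ

/-- `A` is a subcomplex of the smooth CW complex `X`: it is a smooth CW complex all of whose
characteristic maps are characteristic maps of `X`. -/
def RelCWComplex.IsSubcomplex {X : Type u} [DiffeologicalSpace X]
    (c : CWComplex.{u, w} X) (A : Set X) : Prop :=
  ∃ a : CWComplex.{u, w} A, ∀ n (l : a.cell n), ∃ l' : c.cell n,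
    ∀ t : cube n, ((a.charMap n l t : A) : X) = c.charMap n l' t

/-! ### Homotopies and homotopy groups -/

section Homotopy

variable {X : Type u} {Y : Type v} [DiffeologicalSpace X] [DiffeologicalSpace Y]

/-- The maps `f₀, f₁ : (X, A) → (Y, B)` are smoothly homotopic as maps of pairs. -/
def PairHomotopic (A : Set X) (B : Set Y) (f₀ f₁ : X → Y) : Prop :=
  ∃ H : X × unitInterval → Y, DSmooth H ∧ (∀ x, H (x, 0) = f₀ x) ∧ (∀ x, H (x, 1) = f₁ x) ∧
    ∀ a ∈ A, ∀ t, H (a, t) ∈ B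

/-- The maps `f₀, f₁ : X → Y` are smoothly homotopic. -/
def Homotopic (f₀ f₁ : X → Y) : Prop :=
  ∃ H : X × unitInterval → Y, DSmooth H ∧ (∀ x, H (x, 0) = f₀ x) ∧ (∀ x, H (x, 1) = f₁ x)

/-- `φ : (X, A) → (Y, B)` is a smooth homotopy equivalence of pairs. -/
def IsPairHomotopyEquiv (A : Set X) (B : Set Y) (φ : X → Y) : Prop :=
  DSmooth φ ∧ Set.MapsTo φ A B ∧
    ∃ ψ : Y → X, DSmooth ψ ∧ Set.MapsTo ψ B A ∧
      PairHomotopic A A (ψ ∘ φ) id ∧ PairHomotopic B B (φ ∘ ψ) id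

/-- `φ : X → Y` is a smooth homotopy equivalence. -/
def IsHomotopyEquiv (φ : X → Y) : Prop :=
  DSmooth φ ∧ ∃ ψ : Y → X, DSmooth ψ ∧ Homotopic (ψ ∘ φ) id ∧ Homotopic (φ ∘ ψ) id

/-- Smooth maps of pairs `(X, A) → (Y, B)`. -/
def PairMap (A : Set X) (B : Set Y) : Type (max u v) :=
  {f : X → Y // DSmooth f ∧ Set.MapsTo f A B}

/-- The set `[X, A; Y, B]` of homotopy classes of smooth maps of pairs. -/
def HomotopySet (A : Set X) (B : Set Y) : Type (max u v) :=
  Quot fun f g : PairMap A B => PairHomotopic A B f.1 g.1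

/-- The underlying set of `π_n(X, x) = [I ^ n, ∂ I ^ n; X, x]`, for `n ≥ 0`. -/
def HomotopyGrp (n : ℕ) (x : X) : Type u :=
  HomotopySet (cubeBoundary n) ({x} : Set X)

/-- The induced map `π_n(X, x) → π_n(Y, f x)`, `[g] ↦ [f ∘ g]`. -/
def HomotopyGrp.map (n : ℕ) (x : X) (f : X → Y) (hf : DSmooth f) :
    HomotopyGrp n x → HomotopyGrp n (f x) :=
  Quot.map
    (fun g => ⟨f ∘ g.1, hf.comp g.2.1, fun _ ht => congrArg f (g.2.2 ht)⟩)
    (fun _ _ ⟨H, hH, h0, h1, hb⟩ => ⟨f ∘ H, hf.comp hH, fun t => congrArg f (h0 t),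
      fun t => congrArg f (h1 t), fun a ha t => congrArg f (hb a ha t)⟩)

/-- `x` and `y` are the end points of a smooth path. -/
def SmoothlyJoined (x y : X) : Prop :=
  ∃ γ : unitInterval → X, DSmooth γ ∧ γ 0 = x ∧ γ 1 = y

/-- The smooth map `f` is an `N`-equivalence: it induces bijections on `π_n` for all `n < N` and
all base points. If `N > 0`, the surjectivity of the map of sets `π_0(X) → π_0(Y)` is meant to
hold also when `X` is empty and thus has no base points; hence the second conjunct. -/
def IsNEquivalence (N : ℕ) (f : X → Y) : Prop :=
  ∃ hf : DSmooth f,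
    (0 < N → ∀ y, ∃ x, SmoothlyJoined (f x) y) ∧
    ∀ (x : X) (n : ℕ), n < N →
      Function.Injective (HomotopyGrp.map n x f hf) ∧
      Function.Surjective (HomotopyGrp.map n x f hf)

/-- The map of pairs `φ : (X, A) → (Y, B)` is an `N`-equivalence: `φ : X → Y` and its restriction
`A → B` are `N`-equivalences. -/
def IsPairNEquivalence (N : ℕ) (A : Set X) (B : Set Y) (φ : X → Y) : Prop :=
  ∃ h : Set.MapsTo φ A B, IsNEquivalence N φ ∧ IsNEquivalence N (h.restrict φ A B)

/-- Weak homotopy equivalences. -/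
def IsWeakEquiv (φ : X → Y) : Prop :=
  ∀ N, IsNEquivalence N φ

/-- Weak homotopy equivalences of pairs. -/
def IsPairWeakEquiv (A : Set X) (B : Set Y) (φ : X → Y) : Prop :=
  ∀ N, IsPairNEquivalence N A B φ

end Homotopy

end SmoothCW

namespace Diffeology

/-! ### Smoothness of maps of diffeological spaces -/

section Basic

open scoped ContDiff

variable {X : Type*} {Y : Type*} {Z : Type*} [DiffeologicalSpace X] [DiffeologicalSpace Y]
  [DiffeologicalSpace Z]

/-! The formal part is the classical one. Suppose every equivalence `φ` has a right homotopy inverse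
`ψ`. Then `φ ∘ ψ ≃ id` forces `ψ` to be an equivalence as well, so `ψ` has a right homotopy inverse
`χ`, and `φ ≃ φ ∘ ψ ∘ χ ≃ χ` gives `ψ ∘ φ ≃ ψ ∘ χ ≃ id` (`isPairHomotopyEquiv_of_equivalence`).

A right inverse is a lift of the identity of `Y` through `φ` up to homotopy. It is built cell by
cell, first on `B` through `A → B` and then on `Y` relative to `B` (`IsLiftOn.exists_lift`). Over an
`n`-cell one needs compressibility: a map of the cube into `Y` with a lift on the boundary deforms,
relative to the boundary, to a map that lifts. Injectivity on `π_(n-1)` extends the boundary lift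
over the cube, and surjectivity on `π_n` corrects the extension by a spheroid (`compressible_succ`).

The difficulty is smoothness: maps that merely agree on a boundary do not glue, and retractions of
`I ^ n × I` onto its bottom and sides are not smooth. Three devices replace them. Maps on cubes are
handled as maps on `ℝ ^ n` controlled on an open collar of the boundary. Homotopies are allowed to
move the collar along a prescribed family `h (s, τ t)`, and homotopy extension is done by cutting
off the time parameter `τ`, never the values (`exists_collar_glue`, `HomotopicAlong`). Finally,
flattening the coordinates near `0` and `1` extends boundary data to a collar; since the attaching
maps are tame, this does not change the data on the boundary (`exists_cell_extension`). Smoothness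
on the whole complex then follows because a plot locally lies in one skeleton and, there, locally
factors through a lower skeleton or a single cell. -/

@[fun_prop]
theorem dSmooth_fst : DSmooth (Prod.fst : X × Y → X) := fun _ _ hp => hp.1

@[fun_prop]
theorem dSmooth_snd : DSmooth (Prod.snd : X × Y → Y) := fun _ _ hp => hp.2

@[fun_prop]
theorem DSmooth.fst {f : Z → X × Y} (hf : DSmooth f) : DSmooth fun z => (f z).1 :=
  dSmooth_fst.comp hf

@[fun_prop]
theorem DSmooth.snd {f : Z → X × Y} (hf : DSmooth f) : DSmooth fun z => (f z).2 :=
  dSmooth_snd.comp hf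

@[fun_prop]
theorem DSmooth.prodMk {f : Z → X} {g : Z → Y} (hf : DSmooth f) (hg : DSmooth g) :
    DSmooth fun z => (f z, g z) := fun m p hp => ⟨hf m p hp, hg m p hp⟩

theorem dSmooth_val {s : X → Prop} : DSmooth (Subtype.val : Subtype s → X) := fun _ _ hp => hp

@[fun_prop]
theorem DSmooth.subtype_val {s : X → Prop} {f : Z → Subtype s} (hf : DSmooth f) :
    DSmooth fun z => (f z : X) := dSmooth_val.comp hf

theorem DSmooth.subtype_mk {s : X → Prop} {f : Z → X} (hf : DSmooth f) (h : ∀ z, s (f z)) :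
    DSmooth fun z => (⟨f z, h z⟩ : Subtype s) := fun m p hp => hf m p hp

@[fun_prop]
theorem DSmooth.add {f g : Z → ℝ} (hf : DSmooth f) (hg : DSmooth g) :
    DSmooth fun z => f z + g z := fun m p hp =>
  ContDiff.isPlot (ContDiff.add (hf m p hp).contDiff (hg m p hp).contDiff)

@[fun_prop]
theorem DSmooth.sub {f g : Z → ℝ} (hf : DSmooth f) (hg : DSmooth g) :
    DSmooth fun z => f z - g z := fun m p hp =>
  ContDiff.isPlot (ContDiff.sub (hf m p hp).contDiff (hg m p hp).contDiff)

@[fun_prop]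
theorem DSmooth.mul {f g : Z → ℝ} (hf : DSmooth f) (hg : DSmooth g) :
    DSmooth fun z => f z * g z := fun m p hp =>
  ContDiff.isPlot (ContDiff.mul (hf m p hp).contDiff (hg m p hp).contDiff)

theorem dSmooth_euclidean_iff {n : ℕ} {f : Z → EuclideanSpace ℝ (Fin n)} :
    DSmooth f ↔ ∀ j, DSmooth fun z => f z j := by
  constructor
  · intro hf j m p hp
    exact ContDiff.isPlot (contDiff_euclidean.1 (hf m p hp).contDiff j)
  · intro hf m p hp
    exact ContDiff.isPlot (contDiff_euclidean.2 fun j => (hf j m p hp).contDiff)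

@[fun_prop]
theorem DSmooth.euclidean_apply {n : ℕ} {f : Z → EuclideanSpace ℝ (Fin n)} (hf : DSmooth f)
    (j : Fin n) : DSmooth fun z => f z j := dSmooth_euclidean_iff.1 hf j

/-- The map `f` sends plots that lie in `S` to plots. -/
def SmoothOn (f : X → Y) (S : Set X) : Prop :=
  ∀ (m : ℕ) (p : EuclideanSpace ℝ (Fin m) → X), IsPlot p → (∀ r, p r ∈ S) → IsPlot (f ∘ p)

theorem DSmooth.smoothOn {f : X → Y} (hf : DSmooth f) (S : Set X) : SmoothOn f S :=
  fun m p hp _ => hf m p hp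

theorem SmoothOn.dSmooth {f : X → Y} (hf : SmoothOn f Set.univ) : DSmooth f :=
  fun m p hp => hf m p hp fun _ => trivial

theorem SmoothOn.mono {f : X → Y} {S T : Set X} (hf : SmoothOn f T) (h : S ⊆ T) :
    SmoothOn f S := fun m p hp hS => hf m p hp fun r => h (hS r)

theorem SmoothOn.congr {f g : X → Y} {S : Set X} (hg : SmoothOn g S) (h : Set.EqOn f g S) :
    SmoothOn f S := fun m p hp hS => by
  have : f ∘ p = g ∘ p := funext fun r => h (hS r)
  rw [this]
  exact hg m p hp hS

theorem SmoothOn.comp {f : X → Y} {g : Y → Z} {S : Set X} {T : Set Y} (hg : SmoothOn g T)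
    (hf : SmoothOn f S) (h : Set.MapsTo f S T) : SmoothOn (fun x => g (f x)) S :=
  fun m p hp hS => hg m _ (hf m p hp hS) fun r => h (hS r)

theorem SmoothOn.comp_dSmooth {f : X → Y} {g : Y → Z} {T : Set Y} (hg : SmoothOn g T)
    (hf : DSmooth f) (h : ∀ x, f x ∈ T) : DSmooth (fun x => g (f x)) :=
  fun m p hp => hg m _ (hf m p hp) fun r => h (p r)

theorem smoothOn_of_subtype {f : X → Y} {S : Set X} (hf : DSmooth fun x : S => f x) :
    SmoothOn f S := fun m p hp hS => hf m (fun r => ⟨p r, hS r⟩) hp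

theorem isPlot_of_locally {m : ℕ} {p : EuclideanSpace ℝ (Fin m) → X}
    (h : ∀ r, ∃ U ∈ 𝓝 r, ∀ (k : ℕ) (f : EuclideanSpace ℝ (Fin k) → EuclideanSpace ℝ (Fin m)),
      (∀ x, f x ∈ U) → ContDiff ℝ ∞ f → IsPlot (p ∘ f)) : IsPlot p :=
  DiffeologicalSpace.locality fun r => by
    obtain ⟨U, hU, hf⟩ := h r
    obtain ⟨V, hVU, hV, hr⟩ := mem_nhds_iff.1 hU
    exact ⟨V, hV, hr, fun hx hs => hf _ _ (fun x => hVU (hx x)) hs⟩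

/-- A map is smooth on `S` if every plot in `S` lies locally in sets on which it is smooth. -/
theorem smoothOn_of_locally {f : X → Y} {S : Set X}
    (h : ∀ (m : ℕ) (p : EuclideanSpace ℝ (Fin m) → X), IsPlot p → (∀ r, p r ∈ S) →
      ∀ r, ∃ T : Set X, SmoothOn f T ∧ ∀ᶠ r' in 𝓝 r, p r' ∈ T) : SmoothOn f S := by
  intro m p hp hS
  refine isPlot_of_locally fun r => ?_
  obtain ⟨T, hT, hr⟩ := h m p hp hS r
  exact ⟨_, hr, fun k g hg hs => hT k _ (isPlot_reparam hp hs) hg⟩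

/-- Gluing two maps that agree on the overlap of two open sets. -/
theorem DSmooth.glue {V : Type*} [TopologicalSpace V] {π : X → V} {f : X → Y} {U₁ U₂ : Set V}
    (hπ : ∀ (m : ℕ) (p : EuclideanSpace ℝ (Fin m) → X), IsPlot p → Continuous (π ∘ p))
    (h₁ : IsOpen U₁) (h₂ : IsOpen U₂) (hU : U₁ ∪ U₂ = Set.univ)
    (hf₁ : SmoothOn f (π ⁻¹' U₁)) (hf₂ : SmoothOn f (π ⁻¹' U₂)) : DSmooth f := by
  refine (smoothOn_of_locally fun m p hp _ r => ?_).dSmooth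
  have hr : π (p r) ∈ U₁ ∪ U₂ := hU ▸ Set.mem_univ _
  rcases hr with hr | hr
  · exact ⟨_, hf₁, (hπ m p hp).continuousAt.eventually (h₁.mem_nhds hr)⟩
  · exact ⟨_, hf₂, (hπ m p hp).continuousAt.eventually (h₂.mem_nhds hr)⟩

/-- A smooth self-map of `ℝ ^ m` with values in a neighbourhood of `r` that is the identity
near `r`. -/
theorem exists_localization {m : ℕ} {r : EuclideanSpace ℝ (Fin m)}
    {U : Set (EuclideanSpace ℝ (Fin m))} (hU : U ∈ 𝓝 r) :
    ∃ β : EuclideanSpace ℝ (Fin m) → EuclideanSpace ℝ (Fin m), ContDiff ℝ ∞ β ∧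
      (∀ x, β x ∈ U) ∧ ∀ᶠ x in 𝓝 r, β x = x := by
  obtain ⟨ε, hε, hεU⟩ := Metric.mem_nhds_iff.1 hU
  let χ : ContDiffBump r := ⟨ε / 2, ε, by positivity, by linarith⟩
  refine ⟨fun x => r + χ x • (x - r), ?_, fun x => hεU ?_, ?_⟩
  · exact contDiff_const.add (χ.contDiff.smul (contDiff_id.sub contDiff_const))
  · change r + χ x • (x - r) ∈ _
    by_cases hx : dist x r < ε
    · rw [Metric.mem_ball, dist_eq_norm, add_sub_cancel_left, norm_smul, Real.norm_eq_abs,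
        abs_of_nonneg χ.nonneg]
      rw [dist_eq_norm] at hx
      exact lt_of_le_of_lt (mul_le_of_le_one_left (norm_nonneg _) χ.le_one) hx
    · rw [χ.zero_of_le_dist (not_lt.1 hx), zero_smul, add_zero]
      exact Metric.mem_ball_self hε
  · filter_upwards [Metric.closedBall_mem_nhds r (half_pos hε)] with x hx
    rw [χ.one_of_mem_closedBall hx, one_smul, add_sub_cancel]

theorem DSmooth.continuous_comp_isPlot {f : X → ℝ} (hf : DSmooth f) (m : ℕ)
    (p : EuclideanSpace ℝ (Fin m) → X) (hp : IsPlot p) : Continuous (f ∘ p) :=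
  (hf m p hp).contDiff.continuous

end Basic

end Diffeology

namespace SmoothCW

/-! ### Concatenation of homotopies parametrized by the real line -/

section Concat

variable {Z : Type*} {X : Type*}

/-- The smooth transition function from `0` to `1`. -/
noncomputable abbrev step : ℝ → ℝ := Real.smoothTransition

theorem contDiff_step : ContDiff ℝ (⊤ : ℕ∞) step := Real.smoothTransition.contDiff

@[fun_prop]
theorem dSmooth_step : DSmooth step := contDiff_step.dSmooth

/-- Follow `F` during `[0, 1 / 4]` and `G` during `[3 / 4, 1]`. -/
noncomputable def concat (F G : Z × ℝ → X) (z : Z × ℝ) : X :=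
  if z.2 < 1 / 2 then F (z.1, step (4 * z.2)) else G (z.1, step (4 * z.2 - 3))

theorem concat_zero (F G : Z × ℝ → X) (z : Z) : concat F G (z, 0) = F (z, 0) := by
  simp [concat, Real.smoothTransition.zero]

theorem concat_one (F G : Z × ℝ → X) (z : Z) : concat F G (z, 1) = G (z, 1) := by
  have : step (4 * 1 - 3) = 1 := by norm_num [Real.smoothTransition.one]
  simp only [concat, this]
  norm_num

/-- Both branches are stationary on `[1 / 4, 3 / 4]`, so matching values suffice and no condition on
derivatives at the junction is needed. -/
theorem dSmooth_concat [DiffeologicalSpace X] [DiffeologicalSpace Z] {F G : Z × ℝ → X} (hF : DSmooth F) (hG : DSmooth G)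
    (h : ∀ z, F (z, 1) = G (z, 0)) : DSmooth (concat F G) := by
  refine DSmooth.glue (π := Prod.snd) (U₁ := Set.Iio (2 / 3)) (U₂ := Set.Ioi (1 / 2))
    dSmooth_snd.continuous_comp_isPlot isOpen_Iio isOpen_Ioi ?_ ?_ ?_
  · ext x
    simp only [Set.mem_union, Set.mem_Iio, Set.mem_Ioi, Set.mem_univ, iff_true]
    by_contra! hx
    linarith
  · refine (DSmooth.smoothOn (f := fun z : Z × ℝ => F (z.1, step (4 * z.2))) (by fun_prop) _).congr
      fun z hz => ?_
    unfold concat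
    split_ifs with h2
    · rfl
    · have hz' : z.2 < 2 / 3 := hz
      beta_reduce
      rw [show step (4 * z.2 - 3) = 0 from Real.smoothTransition.zero_of_nonpos (by linarith),
        show step (4 * z.2) = 1 from Real.smoothTransition.one_of_one_le (by linarith), h]
  · refine (DSmooth.smoothOn (f := fun z : Z × ℝ => G (z.1, step (4 * z.2 - 3))) (by fun_prop)
      _).congr fun z hz => ?_
    have hz' : 1 / 2 < z.2 := hz
    rw [concat, if_neg (not_lt.2 hz'.le)]

end Concat

/-! ### Collars of the boundary of the cube -/

section Collar

open scoped ContDiff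

variable {n : ℕ}

/-- The open collar of width `ε` around the complement of the open cube in `ℝ ^ n`. -/
def collar (n : ℕ) (ε : ℝ) : Set (EuclideanSpace ℝ (Fin n)) :=
  {s | ∃ j, s j < ε ∨ 1 - ε < s j}

theorem collar_mono {ε ε' : ℝ} (h : ε ≤ ε') : collar n ε ⊆ collar n ε' :=
  fun _ ⟨j, hj⟩ => ⟨j, hj.imp (fun h' => by linarith) fun h' => by linarith⟩

theorem isOpen_collar (ε : ℝ) : IsOpen (collar n ε) := by
  have : collar n ε = ⋃ j, {s : EuclideanSpace ℝ (Fin n) | s j < ε ∨ 1 - ε < s j} := by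
    ext; simp [collar]
  rw [this]
  refine isOpen_iUnion fun j => ?_
  have hc : Continuous fun s : EuclideanSpace ℝ (Fin n) => s j := by fun_prop
  exact (isOpen_lt hc continuous_const).union (isOpen_lt continuous_const hc)

theorem isOpen_exterior (ε : ℝ) : IsOpen {s : EuclideanSpace ℝ (Fin n) |
    ∀ j, ε < s j ∧ s j < 1 - ε} := by
  have : {s : EuclideanSpace ℝ (Fin n) | ∀ j, ε < s j ∧ s j < 1 - ε} =
      ⋂ j, {s : EuclideanSpace ℝ (Fin n) | ε < s j ∧ s j < 1 - ε} := by
    ext; simp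
  rw [this]
  refine isOpen_iInter_of_finite fun j => ?_
  have hc : Continuous fun s : EuclideanSpace ℝ (Fin n) => s j := by fun_prop
  exact (isOpen_lt continuous_const hc).inter (isOpen_lt hc continuous_const)

/-- A cutoff function that is `1` on a collar and vanishes outside of a larger one. -/
theorem exists_cutoff (n : ℕ) {ε : ℝ} (hε : 0 < ε) :
    ∃ ρ : EuclideanSpace ℝ (Fin n) → ℝ, DSmooth ρ ∧ (∀ s ∈ collar n (ε / 3), ρ s = 1) ∧
      ∀ s, (∀ j, 2 * ε / 3 ≤ s j ∧ s j ≤ 1 - 2 * ε / 3) → ρ s = 0 := by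
  -- The first factor rises from `0` to `1` between `ε / 3` and `2 * ε / 3`; the second is its
  -- mirror image at the other end.
  let b : ℝ → ℝ := fun t => step (3 / ε * t - 1) * step (3 / ε * (1 - t) - 1)
  have hb : ContDiff ℝ ∞ b :=
    (contDiff_step.comp (by fun_prop)).mul (contDiff_step.comp (by fun_prop))
  have e : ∀ t, 3 / ε * t = t / ε * 3 := fun t => by ring
  refine ⟨fun s => 1 - ∏ j, b (s j), ?_, ?_, ?_⟩
  · refine ContDiff.dSmooth (contDiff_const.sub (contDiff_prod fun j _ => hb.comp ?_))
    exact contDiff_euclidean.1 contDiff_id j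
  · rintro s ⟨j, hj⟩
    have : b (s j) = 0 := by
      rcases hj with hj | hj
      · have : s j / ε < 1 / 3 := by rw [div_lt_iff₀ hε]; linarith
        simp only [b, Real.smoothTransition.zero_of_nonpos (x := 3 / ε * s j - 1)
          (by rw [e]; linarith), zero_mul]
      · have : (1 - s j) / ε < 1 / 3 := by rw [div_lt_iff₀ hε]; linarith
        simp only [b, Real.smoothTransition.zero_of_nonpos (x := 3 / ε * (1 - s j) - 1)
          (by rw [e]; linarith), mul_zero]
    have h0 : ∏ j, b (s j) = 0 := Finset.prod_eq_zero (Finset.mem_univ j) this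
    simp only [h0, sub_zero]
  · intro s hs
    have : ∀ j, b (s j) = 1 := fun j => by
      have h1 : 2 / 3 ≤ s j / ε := by rw [le_div_iff₀ hε]; linarith [(hs j).1]
      have h2 : 2 / 3 ≤ (1 - s j) / ε := by rw [le_div_iff₀ hε]; linarith [(hs j).2]
      simp only [b, Real.smoothTransition.one_of_one_le (x := 3 / ε * s j - 1)
          (by rw [e]; linarith), Real.smoothTransition.one_of_one_le (x := 3 / ε * (1 - s j) - 1)
          (by rw [e]; linarith), mul_one]
    simp [this]

variable {X : Type*} [DiffeologicalSpace X]

/-- Near the boundary of the cube, a family `F (s, t) = h (s, v t)` can be replaced by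
`h (s, w t)`. -/
theorem exists_collar_glue {F h : EuclideanSpace ℝ (Fin n) × ℝ → X} {v w : ℝ → ℝ} {ε : ℝ}
    (hε : 0 < ε) (hF : DSmooth F) (hh : SmoothOn h (collar n ε ×ˢ Set.univ))
    (hv : ContDiff ℝ ∞ v) (hw : ContDiff ℝ ∞ w)
    (hFh : ∀ s ∈ collar n ε, ∀ t, F (s, t) = h (s, v t)) :
    ∃ G : EuclideanSpace ℝ (Fin n) × ℝ → X, DSmooth G ∧
      (∀ s t, v t = w t → G (s, t) = F (s, t)) ∧
      ∃ ε' > 0, ∀ s ∈ collar n ε', ∀ t, G (s, t) = h (s, w t) := by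
  classical
  obtain ⟨ρ, hρ, hρ1, hρ0⟩ := exists_cutoff n hε
  -- `X` has no linear structure, so the interpolation between `v` and `w` takes place in the time
  -- argument of `h`.
  let G : EuclideanSpace ℝ (Fin n) × ℝ → X := fun z =>
    if z.1 ∈ collar n ε then h (z.1, v z.2 + ρ z.1 * (w z.2 - v z.2)) else F z
  have hG1 : ∀ s ∈ collar n ε, ∀ t, G (s, t) = h (s, v t + ρ s * (w t - v t)) :=
    fun s hs t => if_pos hs
  refine ⟨G, ?_, ?_, ε / 3, by positivity, fun s hs t => ?_⟩
  · refine DSmooth.glue (π := Prod.fst) (U₁ := collar n ε)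
      (U₂ := {s | ∀ j, 2 * ε / 3 < s j ∧ s j < 1 - 2 * ε / 3})
      (fun m p hp => (dSmooth_fst m p hp).contDiff.continuous) (isOpen_collar ε)
      (isOpen_exterior _) ?_ ?_ ?_
    · ext s
      simp only [Set.mem_union, Set.mem_univ, iff_true]
      by_cases hs : s ∈ collar n ε
      · exact Or.inl hs
      · refine Or.inr fun j => ?_
        simp only [collar, Set.mem_ofPred_eq, not_exists, not_or, not_lt] at hs
        constructor <;> linarith [(hs j).1, (hs j).2]
    · refine SmoothOn.congr (g := fun z => h (z.1, v z.2 + ρ z.1 * (w z.2 - v z.2))) ?_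
        fun z hz => hG1 _ hz _
      exact hh.comp (DSmooth.smoothOn (by fun_prop) _) fun z hz => ⟨hz, trivial⟩
    · refine (hF.smoothOn _).congr fun z hz => ?_
      by_cases hs : z.1 ∈ collar n ε
      · rw [show G z = _ from hG1 z.1 hs z.2, hρ0 _ fun j => ⟨(hz j).1.le, (hz j).2.le⟩,
          zero_mul, add_zero, ← hFh _ hs]
      · exact if_neg hs
  · intro s t hvw
    by_cases hs : s ∈ collar n ε
    · rw [hG1 s hs, hvw, sub_self, mul_zero, add_zero, hFh s hs, hvw]
    · exact if_neg hs
  · rw [hG1 s (collar_mono (by linarith) hs), hρ1 s hs, one_mul, add_sub_cancel]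

end Collar

/-! ### Homotopies with prescribed behaviour near the boundary of the cube -/

section CollarHomotopy

open scoped ContDiff

variable {n : ℕ} {X : Type*} {Y : Type*} [DiffeologicalSpace X] [DiffeologicalSpace Y]
  {h : EuclideanSpace ℝ (Fin n) × ℝ → X} {p q r : ℝ} {a b c a' b' : EuclideanSpace ℝ (Fin n) → X}

/-- The maps `a` and `b` are homotopic by a homotopy that is given, near the boundary of the cube,
by the family `h` running from parameter `p` to parameter `q`. -/
def HomotopicAlong (h : EuclideanSpace ℝ (Fin n) × ℝ → X) (p q : ℝ)
    (a b : EuclideanSpace ℝ (Fin n) → X) : Prop :=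
  ∃ (M : EuclideanSpace ℝ (Fin n) × ℝ → X) (τ : ℝ → ℝ), DSmooth M ∧ ContDiff ℝ ∞ τ ∧
    τ 0 = p ∧ τ 1 = q ∧ (∀ s, M (s, 0) = a s) ∧ (∀ s, M (s, 1) = b s) ∧
    ∃ ε > 0, ∀ s ∈ collar n ε, ∀ t, M (s, t) = h (s, τ t)

/-- The maps `a` and `b` are homotopic by a homotopy that is constant near the boundary of the
cube. -/
def HomotopicRel (a b : EuclideanSpace ℝ (Fin n) → X) : Prop :=
  ∃ M : EuclideanSpace ℝ (Fin n) × ℝ → X, DSmooth M ∧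
    (∀ s, M (s, 0) = a s) ∧ (∀ s, M (s, 1) = b s) ∧
    ∃ ε > 0, ∀ s ∈ collar n ε, ∀ t, M (s, t) = a s

theorem HomotopicAlong.dSmooth_left (H : HomotopicAlong h p q a b) : DSmooth a := by
  obtain ⟨M, τ, hM, -, -, -, h0, -⟩ := H
  rw [show a = fun s => M (s, 0) from funext fun s => (h0 s).symm]
  fun_prop

theorem HomotopicAlong.symm (H : HomotopicAlong h p q a b) : HomotopicAlong h q p b a := by
  obtain ⟨M, τ, hM, hτ, h0, h1, hM0, hM1, ε, hε, hc⟩ := H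
  refine ⟨fun z => M (z.1, 1 - z.2), fun t => τ (1 - t), by fun_prop, by fun_prop, by simpa,
    by simpa, fun s => by simpa using hM1 s, fun s => by simpa using hM0 s, ε, hε,
    fun s hs t => hc s hs _⟩

theorem HomotopicAlong.dSmooth_right (H : HomotopicAlong h p q a b) : DSmooth b :=
  H.symm.dSmooth_left

theorem HomotopicAlong.exists_left_eq (H : HomotopicAlong h p q a b) :
    ∃ ε > 0, ∀ s ∈ collar n ε, a s = h (s, p) := by
  obtain ⟨M, τ, hM, hτ, h0, h1, hM0, hM1, ε, hε, hc⟩ := H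
  exact ⟨ε, hε, fun s hs => by rw [← hM0, hc s hs, h0]⟩

theorem HomotopicAlong.exists_right_eq (H : HomotopicAlong h p q a b) :
    ∃ ε > 0, ∀ s ∈ collar n ε, b s = h (s, q) := H.symm.exists_left_eq

theorem HomotopicAlong.trans (H : HomotopicAlong h p q a b) (H' : HomotopicAlong h q r b c) :
    HomotopicAlong h p r a c := by
  obtain ⟨M, τ, hM, hτ, h0, h1, hM0, hM1, ε, hε, hc⟩ := H
  obtain ⟨M', τ', hM', hτ', h0', h1', hM0', hM1', ε', hε', hc'⟩ := H'
  -- The boundary parameters are concatenated by the same formula as the homotopies; the extra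
  -- factor `ℝ` is a dummy, evaluated at `0`.
  let T : ℝ × ℝ → ℝ := concat (fun z => τ z.2) (fun z => τ' z.2)
  have hT : DSmooth T := dSmooth_concat (by fun_prop) (by fun_prop) fun z => by rw [h1, h0']
  refine ⟨concat M M', fun t => T (0, t), dSmooth_concat hM hM' fun s => by rw [hM1, hM0'],
    DSmooth.contDiff (by fun_prop), ?_, ?_, fun s => by rw [concat_zero, hM0],
    fun s => by rw [concat_one, hM1'], min ε ε', lt_min hε hε', fun s hs t => ?_⟩
  · simp only [T, concat_zero, h0]
  · simp only [T, concat_one, h1']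
  · simp only [T, concat]
    split_ifs
    · exact hc s (collar_mono (min_le_left _ _) hs) _
    · exact hc' s (collar_mono (min_le_right _ _) hs) _

theorem HomotopicAlong.comp {φ : X → Y} (hφ : DSmooth φ) (H : HomotopicAlong h p q a b) :
    HomotopicAlong (fun z => φ (h z)) p q (fun s => φ (a s)) (fun s => φ (b s)) := by
  obtain ⟨M, τ, hM, hτ, h0, h1, hM0, hM1, ε, hε, hc⟩ := H
  exact ⟨fun z => φ (M z), τ, by fun_prop, hτ, h0, h1, fun s => congrArg φ (hM0 s),
    fun s => congrArg φ (hM1 s), ε, hε, fun s hs t => congrArg φ (hc s hs t)⟩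

/-- The time parametrization near the boundary can be chosen at will. -/
theorem HomotopicAlong.exists_homotopy (H : HomotopicAlong h p q a b) {ε : ℝ} (hε : 0 < ε)
    (hh : SmoothOn h (collar n ε ×ˢ Set.univ)) {τ : ℝ → ℝ} (hτ : ContDiff ℝ ∞ τ) (h0 : τ 0 = p)
    (h1 : τ 1 = q) :
    ∃ M : EuclideanSpace ℝ (Fin n) × ℝ → X, DSmooth M ∧ (∀ s, M (s, 0) = a s) ∧
      (∀ s, M (s, 1) = b s) ∧ ∃ ε > 0, ∀ s ∈ collar n ε, ∀ t, M (s, t) = h (s, τ t) := by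
  obtain ⟨M, τ', hM, hτ', h0', h1', hM0, hM1, ε', hε', hc⟩ := H
  obtain ⟨G, hG, hGM, hGc⟩ := exists_collar_glue (lt_min hε hε') hM
    (hh.mono (Set.prod_mono (collar_mono (min_le_left _ _)) le_rfl)) hτ' hτ
    fun s hs => hc s (collar_mono (min_le_right _ _) hs)
  exact ⟨G, hG, fun s => by rw [hGM s 0 (by rw [h0, h0']), hM0],
    fun s => by rw [hGM s 1 (by rw [h1, h1']), hM1], hGc⟩

/-- The homotopy extension property of the cube. -/
theorem exists_homotopicAlong {ε : ℝ} (hε : 0 < ε) (hh : SmoothOn h (collar n ε ×ˢ Set.univ))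
    (ha : DSmooth a) (p q : ℝ) (hp : ∀ s ∈ collar n ε, a s = h (s, p)) :
    ∃ b, HomotopicAlong h p q a b := by
  obtain ⟨G, hG, hGa, hGc⟩ := exists_collar_glue (F := fun z => a z.1) (v := fun _ => p)
    (w := fun t => p + t * (q - p)) hε (by fun_prop) hh (by fun_prop) (by fun_prop)
    fun s hs _ => hp s hs
  exact ⟨fun s => G (s, 1), G, _, hG, by fun_prop, by simp, by simp,
    fun s => hGa s 0 (by simp), fun s => rfl, hGc⟩

theorem HomotopicRel.homotopicAlong (H : HomotopicRel a b) {ε : ℝ} (hε : 0 < ε)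
    (hp : ∀ s ∈ collar n ε, a s = h (s, p)) : HomotopicAlong h p p a b := by
  obtain ⟨M, hM, hM0, hM1, ε', hε', hc⟩ := H
  exact ⟨M, fun _ => p, hM, contDiff_const, rfl, rfl, hM0, hM1, min ε ε', lt_min hε hε',
    fun s hs t => by
      rw [hc s (collar_mono (min_le_right _ _) hs), hp s (collar_mono (min_le_left _ _) hs)]⟩

/-- Near the boundary the parameter runs through a loop at `p` in the contractible space `ℝ`, so it
may be replaced by the constant `p`. -/
theorem HomotopicAlong.homotopicRel (H : HomotopicAlong h p p a b) {ε : ℝ} (hε : 0 < ε)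
    (hh : SmoothOn h (collar n ε ×ˢ Set.univ)) : HomotopicRel a b := by
  obtain ⟨M, hM, hM0, hM1, ε', hε', hc⟩ :=
    H.exists_homotopy hε hh (τ := fun _ => p) contDiff_const rfl rfl
  exact ⟨M, hM, hM0, hM1, ε', hε', fun s hs t => by rw [hc s hs, ← hc s hs 0, hM0]⟩

theorem HomotopicRel.comp {φ : X → Y} (hφ : DSmooth φ) (H : HomotopicRel a b) :
    HomotopicRel (fun s => φ (a s)) (fun s => φ (b s)) := by
  obtain ⟨M, hM, hM0, hM1, ε, hε, hc⟩ := H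
  exact ⟨fun z => φ (M z), by fun_prop, fun s => congrArg φ (hM0 s), fun s => congrArg φ (hM1 s),
    ε, hε, fun s hs t => congrArg φ (hc s hs t)⟩

theorem HomotopicRel.refl (ha : DSmooth a) : HomotopicRel a a :=
  ⟨fun z => a z.1, by fun_prop, fun _ => rfl, fun _ => rfl, 1, one_pos, fun _ _ _ => rfl⟩

theorem HomotopicRel.dSmooth_left (H : HomotopicRel a b) : DSmooth a :=
  (H.homotopicAlong (h := fun z => a z.1) (p := 0) one_pos fun _ _ => rfl).dSmooth_left

/-- Relative homotopies are homotopies along the stationary family `h (s, t) = a s`, so symmetry and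
transitivity are inherited from `HomotopicAlong`. -/
theorem HomotopicRel.symm (H : HomotopicRel a b) : HomotopicRel b a := by
  have := H.dSmooth_left
  exact (H.homotopicAlong (h := fun z => a z.1) (p := 0) one_pos fun _ _ => rfl).symm.homotopicRel
    one_pos (DSmooth.smoothOn (by fun_prop) _)

theorem HomotopicRel.trans (H : HomotopicRel a b) (H' : HomotopicRel b c) : HomotopicRel a c := by
  have := H.dSmooth_left
  have H1 := H.homotopicAlong (h := fun z => a z.1) (p := 0) one_pos fun _ _ => rfl
  obtain ⟨ε, hε, hb⟩ := H1.exists_right_eq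
  exact (H1.trans (H'.homotopicAlong hε hb)).homotopicRel one_pos
    (DSmooth.smoothOn (by fun_prop) _)

theorem HomotopicAlong.trans_rel (H : HomotopicAlong h p q a b) (H' : HomotopicRel b c) :
    HomotopicAlong h p q a c := by
  obtain ⟨ε, hε, hb⟩ := H.exists_right_eq
  exact H.trans (H'.homotopicAlong hε hb)

/-- Transport along `h` respects homotopies relative to the boundary. -/
theorem HomotopicAlong.transport (H : HomotopicAlong h p q a b) (H' : HomotopicAlong h p q a' b')
    (Ha : HomotopicRel a a') {ε : ℝ} (hε : 0 < ε) (hh : SmoothOn h (collar n ε ×ˢ Set.univ)) :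
    HomotopicRel b b' :=
  ((H.symm.trans_rel Ha).trans H').homotopicRel hε hh

end CollarHomotopy

/-! ### Flattening the ends of the interval -/

section Flatten

open scoped ContDiff

/-- A smooth map `ℝ → [0, 1]` that is constant near `(-∞, 0]` and near `[1, ∞)` and the identity
on `[ε, 1 - ε]`. -/
noncomputable def flatten (ε t : ℝ) : ℝ :=
  (1 - step (2 / ε * (t - (1 - ε)))) * step (2 / ε * t - 1) * t + step (2 / ε * (t - (1 - ε)))

/-- Two real numbers are equal or lie both in `(-∞, ε]` or both in `[1 - ε, ∞)`. -/
def RNear (ε x y : ℝ) : Prop := x = y ∨ (x ≤ ε ∧ y ≤ ε) ∨ (1 - ε ≤ x ∧ 1 - ε ≤ y)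

variable {ε ε' x y t : ℝ}

theorem RNear.mono (h : RNear ε x y) (hε : ε ≤ ε') : RNear ε' x y :=
  h.imp id (Or.imp (fun h => ⟨by linarith [h.1], by linarith [h.2]⟩)
    fun h => ⟨by linarith [h.1], by linarith [h.2]⟩)

@[fun_prop]
theorem contDiff_flatten : ContDiff ℝ ∞ (flatten ε) := by
  have h1 : ContDiff ℝ ∞ fun t : ℝ => step (2 / ε * (t - (1 - ε))) :=
    contDiff_step.comp (by fun_prop)
  have h2 : ContDiff ℝ ∞ fun t : ℝ => step (2 / ε * t - 1) := contDiff_step.comp (by fun_prop)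
  unfold flatten
  fun_prop

@[fun_prop]
theorem dSmooth_flatten : DSmooth (flatten ε) := contDiff_flatten.dSmooth

theorem flatten_of_le_half (hε : 0 < ε) (hε' : ε ≤ 1 / 4) (h : t ≤ ε / 2) : flatten ε t = 0 := by
  have e : t / ε ≤ 1 / 2 := by rw [div_le_iff₀ hε]; linarith
  have h1 : step (2 / ε * t - 1) = 0 :=
    Real.smoothTransition.zero_of_nonpos (by rw [show 2 / ε * t = t / ε * 2 by ring]; linarith)
  have h2 : step (2 / ε * (t - (1 - ε))) = 0 :=
    Real.smoothTransition.zero_of_nonpos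
      (mul_nonpos_of_nonneg_of_nonpos (by positivity) (by linarith))
  simp [flatten, h1, h2]

theorem flatten_of_half_le (hε : 0 < ε) (h : 1 - ε / 2 ≤ t) : flatten ε t = 1 := by
  have e : 1 / 2 ≤ (t - (1 - ε)) / ε := by rw [le_div_iff₀ hε]; linarith
  have h1 : step (2 / ε * (t - (1 - ε))) = 1 :=
    Real.smoothTransition.one_of_one_le
      (by rw [show 2 / ε * (t - (1 - ε)) = (t - (1 - ε)) / ε * 2 by ring]; linarith)
  simp [flatten, h1]

theorem flatten_of_le (hε : 0 < ε) (h : t ≤ 1 - ε) : flatten ε t = step (2 / ε * t - 1) * t := by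
  have h2 : step (2 / ε * (t - (1 - ε))) = 0 :=
    Real.smoothTransition.zero_of_nonpos
      (mul_nonpos_of_nonneg_of_nonpos (by positivity) (by linarith))
  simp [flatten, h2]

theorem flatten_of_ge (hε : 0 < ε) (h : ε ≤ t) :
    flatten ε t = t + step (2 / ε * (t - (1 - ε))) * (1 - t) := by
  have e : 1 ≤ t / ε := by rw [le_div_iff₀ hε]; linarith
  have h1 : step (2 / ε * t - 1) = 1 :=
    Real.smoothTransition.one_of_one_le (by rw [show 2 / ε * t = t / ε * 2 by ring]; linarith)
  rw [flatten, h1]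
  ring

theorem flatten_mem (hε : 0 < ε) (hε' : ε ≤ 1 / 4) : flatten ε t ∈ Set.Icc (0 : ℝ) 1 := by
  rcases le_total t (ε / 2) with h | h
  · simp [flatten_of_le_half hε hε' h]
  rcases le_total (1 - ε / 2) t with h' | h'
  · simp [flatten_of_half_le hε h']
  have a0 := Real.smoothTransition.nonneg (2 / ε * t - 1)
  have a1 := Real.smoothTransition.le_one (2 / ε * t - 1)
  have c0 := Real.smoothTransition.nonneg (2 / ε * (t - (1 - ε)))
  have c1 := Real.smoothTransition.le_one (2 / ε * (t - (1 - ε)))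
  rcases le_total t (1 - ε) with h2 | h2
  · rw [flatten_of_le hε h2]
    exact ⟨mul_nonneg a0 (by linarith), mul_le_one₀ a1 (by linarith) (by linarith)⟩
  · rw [flatten_of_ge hε (by linarith)]
    constructor
    · exact add_nonneg (by linarith) (mul_nonneg c0 (by linarith))
    · nlinarith

/-- Flattening moves points only within an end zone of width `ε`, a move that tame maps do not
notice. It is constant only on the half as wide zones of `flatten_eq_of_near`, which is why `ε` and
`ε / 2` alternate below. -/
theorem flatten_near (hε : 0 < ε) (hε' : ε ≤ 1 / 4) : RNear ε (flatten ε t) t := by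
  rcases le_total t ε with h | h
  · refine Or.inr (Or.inl ⟨?_, h⟩)
    rcases le_total t 0 with h0 | h0
    · rw [flatten_of_le_half hε hε' (by linarith)]
      exact hε.le
    · rw [flatten_of_le hε (by linarith)]
      exact (mul_le_of_le_one_left h0 (Real.smoothTransition.le_one _)).trans h
  rcases le_total t (1 - ε) with h2 | h2
  · have h0 : step (2 / ε * (t - (1 - ε))) = 0 :=
      Real.smoothTransition.zero_of_nonpos
        (mul_nonpos_of_nonneg_of_nonpos (by positivity) (by linarith))
    rw [flatten_of_ge hε h, h0]
    simp [RNear]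
  · refine Or.inr (Or.inr ⟨?_, h2⟩)
    rcases le_total t 1 with h1 | h1
    · rw [flatten_of_ge hε h]
      have := mul_nonneg (Real.smoothTransition.nonneg (2 / ε * (t - (1 - ε)))) (sub_nonneg.2 h1)
      linarith
    · rw [flatten_of_half_le hε (by linarith)]
      linarith

theorem flatten_eq_of_near (hε : 0 < ε) (hε' : ε ≤ 1 / 4) (h : RNear (ε / 2) x y) :
    flatten ε x = flatten ε y := by
  rcases h with rfl | h | h
  · rfl
  · rw [flatten_of_le_half hε hε' h.1, flatten_of_le_half hε hε' h.2]
  · rw [flatten_of_half_le hε h.1, flatten_of_half_le hε h.2]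

theorem flatten_zero (hε : 0 < ε) (hε' : ε ≤ 1 / 4) : flatten ε 0 = 0 :=
  flatten_of_le_half hε hε' (by positivity)

theorem flatten_one (hε : 0 < ε) : flatten ε 1 = 1 := flatten_of_half_le hε (by linarith)

/-- All coordinates of `s` and `s'` are equal or close to the same end of the interval. -/
def Near {n : ℕ} (ε : ℝ) (s s' : EuclideanSpace ℝ (Fin n)) : Prop := ∀ j, RNear ε (s j) (s' j)

end Flatten

/-! ### Spheroids and the compression property -/

section Spheroids

variable {n : ℕ} {X : Type*} {Y : Type*} [DiffeologicalSpace X] [DiffeologicalSpace Y]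

/-- The map `φ` is injective on homotopy classes of maps `ℝ ^ n → X` that are constant near the
boundary of the cube. -/
def InjOnSpheroids (n : ℕ) (φ : X → Y) : Prop :=
  ∀ (x : X) (a b : EuclideanSpace ℝ (Fin n) → X), DSmooth a → DSmooth b → ∀ ε > 0,
    (∀ s ∈ collar n ε, a s = x) → (∀ s ∈ collar n ε, b s = x) →
    HomotopicRel (fun s => φ (a s)) (fun s => φ (b s)) → HomotopicRel a b

/-- The map `φ` is surjective on homotopy classes of maps `ℝ ^ n → X` that are constant near the
boundary of the cube. -/
def SurjOnSpheroids (n : ℕ) (φ : X → Y) : Prop :=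
  ∀ (x : X) (b : EuclideanSpace ℝ (Fin n) → Y), DSmooth b → ∀ ε > 0,
    (∀ s ∈ collar n ε, b s = φ x) →
    ∃ a : EuclideanSpace ℝ (Fin n) → X, DSmooth a ∧ (∃ ε > 0, ∀ s ∈ collar n ε, a s = x) ∧
      HomotopicRel (fun s => φ (a s)) b

theorem dSmooth_contraction :
    DSmooth fun z : EuclideanSpace ℝ (Fin n) × ℝ => (1 - z.2) • z.1 := by
  refine dSmooth_euclidean_iff.2 fun j => ?_
  simp only [PiLp.smul_apply, smul_eq_mul]
  fun_prop

/-- Contracting the domain makes the boundary values constant. Transport along this family reduces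
statements about arbitrary boundary values to statements about spheroids. -/
theorem homotopicAlong_contraction {a : EuclideanSpace ℝ (Fin n) → X} (ha : DSmooth a) :
    HomotopicAlong (fun z => a ((1 - z.2) • z.1)) 0 1 a (fun _ => a 0) :=
  ⟨_, id, ha.comp dSmooth_contraction, contDiff_id, rfl, rfl, fun s => by simp, fun s => by simp,
    1, one_pos, fun _ _ _ => rfl⟩

/-- Transport along the contraction of `a` turns `a` into a constant and `b` into a spheroid `c`.
Injectivity applies to these, and transporting back yields the claim. -/
theorem InjOnSpheroids.homotopicRel {φ : X → Y} (hφ : DSmooth φ) (hinj : InjOnSpheroids n φ)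
    {a b : EuclideanSpace ℝ (Fin n) → X} (ha : DSmooth a) (hb : DSmooth b) {ε : ℝ} (hε : 0 < ε)
    (hab : ∀ s ∈ collar n ε, b s = a s)
    (H : HomotopicRel (fun s => φ (a s)) (fun s => φ (b s))) : HomotopicRel a b := by
  have hs : DSmooth fun z : EuclideanSpace ℝ (Fin n) × ℝ => a ((1 - z.2) • z.1) :=
    ha.comp dSmooth_contraction
  have Ha := homotopicAlong_contraction ha
  obtain ⟨c, Hc⟩ := exists_homotopicAlong hε (hs.smoothOn _) hb 0 1 fun s hs => by
    simp [hab s hs]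
  have H' := (Ha.comp hφ).transport (Hc.comp hφ) H one_pos ((hφ.comp hs).smoothOn _)
  obtain ⟨ε', hε', hc⟩ := Hc.exists_right_eq
  have := hinj (a 0) _ _ dSmooth_const Hc.dSmooth_right ε' hε' (fun _ _ => rfl)
    (fun s hs => by simp [hc s hs]) H'
  exact Ha.symm.transport Hc.symm this one_pos (hs.smoothOn _)

/-- Push the boundary values of `f` to a point along the contraction of `g`, lift the resulting
spheroid, and undo the contraction in `X`. -/
theorem SurjOnSpheroids.exists_homotopicRel {φ : X → Y} (hφ : DSmooth φ)
    (hsurj : SurjOnSpheroids n φ) {g : EuclideanSpace ℝ (Fin n) → X}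
    {f : EuclideanSpace ℝ (Fin n) → Y} (hg : DSmooth g) (hf : DSmooth f) {ε : ℝ} (hε : 0 < ε)
    (hfg : ∀ s ∈ collar n ε, f s = φ (g s)) :
    ∃ g' : EuclideanSpace ℝ (Fin n) → X, DSmooth g' ∧ (∃ ε > 0, ∀ s ∈ collar n ε, g' s = g s) ∧
      HomotopicRel f (fun s => φ (g' s)) := by
  have hs : DSmooth fun z : EuclideanSpace ℝ (Fin n) × ℝ => g ((1 - z.2) • z.1) :=
    hg.comp dSmooth_contraction
  obtain ⟨c, Hc⟩ := exists_homotopicAlong hε ((hφ.comp hs).smoothOn _) hf 0 1 fun s hs => by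
    simp [hfg s hs]
  obtain ⟨ε', hε', hc⟩ := Hc.exists_right_eq
  obtain ⟨e, he, ⟨δ, hδ, heδ⟩, H⟩ := hsurj (g 0) c Hc.dSmooth_right ε' hε'
    fun s hs => by simp [hc s hs]
  obtain ⟨g', Hg'⟩ := exists_homotopicAlong hδ (hs.smoothOn _) he 1 0 fun s hs => by
    simp [heδ s hs]
  obtain ⟨δ', hδ', hg'⟩ := Hg'.exists_right_eq
  refine ⟨g', Hg'.dSmooth_right, ⟨δ', hδ', fun s hs => by simp [hg' s hs]⟩, ?_⟩
  exact ((Hg'.comp hφ).transport Hc.symm H one_pos ((hφ.comp hs).smoothOn _)).symm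

/-- Every map `f` into `Y` that lifts to `X` near the boundary of the `n`-cube can be deformed,
relative to the boundary, to a map that lifts to `X`. -/
def Compressible (n : ℕ) (φ : X → Y) : Prop :=
  ∀ (ε : ℝ) (g : EuclideanSpace ℝ (Fin n) → X) (f : EuclideanSpace ℝ (Fin n) → Y),
    0 < ε → ε ≤ 1 / 4 → SmoothOn g (collar n ε) → (∀ s s', Near ε s s' → g s = g s') →
    DSmooth f → (∀ s ∈ collar n ε, f s = φ (g s)) →
    ∃ g' : EuclideanSpace ℝ (Fin n) → X, DSmooth g' ∧ (∃ ε > 0, ∀ s ∈ collar n ε, g' s = g s) ∧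
      HomotopicRel f (fun s => φ (g' s))

/-- Adding a first coordinate. -/
def consCoord (z : EuclideanSpace ℝ (Fin n) × ℝ) : EuclideanSpace ℝ (Fin (n + 1)) :=
  WithLp.toLp 2 (Fin.cons z.2 z.1)

/-- Removing the first coordinate. -/
def tailCoord (s : EuclideanSpace ℝ (Fin (n + 1))) : EuclideanSpace ℝ (Fin n) :=
  WithLp.toLp 2 fun j => s j.succ

@[simp]
theorem consCoord_zero (z : EuclideanSpace ℝ (Fin n) × ℝ) : consCoord z 0 = z.2 := rfl

@[simp]
theorem consCoord_succ (z : EuclideanSpace ℝ (Fin n) × ℝ) (j : Fin n) :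
    consCoord z j.succ = z.1 j := rfl

@[simp]
theorem tailCoord_apply (s : EuclideanSpace ℝ (Fin (n + 1))) (j : Fin n) :
    tailCoord s j = s j.succ := rfl

theorem consCoord_tailCoord (s : EuclideanSpace ℝ (Fin (n + 1))) :
    consCoord (tailCoord s, s 0) = s := by
  ext j
  refine Fin.cases ?_ (fun j => ?_) j <;> simp

@[fun_prop]
theorem dSmooth_consCoord : DSmooth (consCoord (n := n)) :=
  dSmooth_euclidean_iff.2 fun j => by
    refine Fin.cases ?_ (fun j => ?_) j
    · simp only [consCoord_zero]; fun_prop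
    · simp only [consCoord_succ]; fun_prop

@[fun_prop]
theorem dSmooth_tailCoord : DSmooth (tailCoord (n := n)) :=
  dSmooth_euclidean_iff.2 fun j => by simp only [tailCoord_apply]; fun_prop

/-- View the cube as a family of `n`-cubes over the first coordinate: `g` gives a bottom `a`, a top
`b` and the side family. Pushing `a` along the sides gives `c` with the boundary values of `b`, and
`f` shows that `φ ∘ c` and `φ ∘ b` are homotopic relative to the boundary. Hence so are `c` and `b`,
and the resulting homotopy from `a` to `b` along the sides is the extension. -/
theorem InjOnSpheroids.exists_extension {φ : X → Y} (hφ : DSmooth φ) (hinj : InjOnSpheroids n φ)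
    {ε : ℝ} {g : EuclideanSpace ℝ (Fin (n + 1)) → X} {f : EuclideanSpace ℝ (Fin (n + 1)) → Y}
    (hε : 0 < ε) (hε' : ε ≤ 1 / 4) (hg : SmoothOn g (collar (n + 1) ε))
    (hnear : ∀ s s', Near ε s s' → g s = g s') (hf : DSmooth f)
    (hfg : ∀ s ∈ collar (n + 1) ε, f s = φ (g s)) :
    ∃ g' : EuclideanSpace ℝ (Fin (n + 1)) → X, DSmooth g' ∧
      ∃ ε > 0, ∀ s ∈ collar (n + 1) ε, g' s = g s := by
  have h0 : ∀ s : EuclideanSpace ℝ (Fin n), consCoord (s, 0) ∈ collar (n + 1) ε :=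
    fun s => ⟨0, Or.inl hε⟩
  have h1 : ∀ s : EuclideanSpace ℝ (Fin n), consCoord (s, 1) ∈ collar (n + 1) ε :=
    fun s => ⟨0, Or.inr (by simpa using hε)⟩
  have hc : ∀ s ∈ collar n ε, ∀ t : ℝ, consCoord (s, t) ∈ collar (n + 1) ε :=
    fun s ⟨j, hj⟩ t => ⟨j.succ, hj⟩
  have hcons : ∀ (s : EuclideanSpace ℝ (Fin n)) (t t' : ℝ), RNear ε t t' →
      g (consCoord (s, t)) = g (consCoord (s, t')) := fun s t t' h =>
    hnear _ _ fun j => Fin.cases h (fun j => Or.inl rfl) j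
  have ha : DSmooth fun s : EuclideanSpace ℝ (Fin n) => g (consCoord (s, 0)) :=
    hg.comp_dSmooth (by fun_prop) h0
  have hb : DSmooth fun s : EuclideanSpace ℝ (Fin n) => g (consCoord (s, 1)) :=
    hg.comp_dSmooth (by fun_prop) h1
  have hh : SmoothOn (fun z : EuclideanSpace ℝ (Fin n) × ℝ => g (consCoord z))
      (collar n ε ×ˢ Set.univ) := hg.comp (dSmooth_consCoord.smoothOn _) fun z hz => hc _ hz.1 _
  obtain ⟨c, Hc⟩ := exists_homotopicAlong hε hh ha 0 1 fun _ _ => rfl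
  have Hf : HomotopicAlong (fun z : EuclideanSpace ℝ (Fin n) × ℝ => φ (g (consCoord z))) 0 1
      (fun s => φ (g (consCoord (s, 0)))) (fun s => φ (g (consCoord (s, 1)))) :=
    ⟨fun z => f (consCoord z), id, by fun_prop, contDiff_id, rfl, rfl, fun s => hfg _ (h0 s),
      fun s => hfg _ (h1 s), ε, hε, fun s hs t => hfg _ (hc s hs t)⟩
  have Hcb := (Hc.comp hφ).transport Hf (HomotopicRel.refl (hφ.comp ha)) hε
    (hφ.smoothOn Set.univ |>.comp hh fun _ _ => trivial)
  obtain ⟨δ, hδ, hcδ⟩ := Hc.exists_right_eq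
  have H := Hc.trans_rel (hinj.homotopicRel hφ Hc.dSmooth_right hb hδ
    (fun s hs => (hcδ s hs).symm) Hcb)
  obtain ⟨M, hM, hM0, hM1, δ', hδ', hMc⟩ := H.exists_homotopy hε hh contDiff_id rfl rfl
  -- Flattening the first coordinate makes the extension agree with `g` near the bottom and top
  -- faces, not only on them.
  refine ⟨fun s => M (tailCoord s, flatten ε (s 0)), by fun_prop, min δ' (ε / 2),
    lt_min hδ' (by positivity), fun s hs => ?_⟩
  beta_reduce
  conv_rhs => rw [← consCoord_tailCoord s]
  obtain ⟨j, hj⟩ := hs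
  revert hj
  refine Fin.cases (fun hj => ?_) (fun j hj => ?_) j
  · rcases hj with hj | hj
    · have hj' : s 0 ≤ ε / 2 := (hj.trans_le (min_le_right _ _)).le
      rw [flatten_of_le_half hε hε' hj', hM0]
      exact hcons _ _ _ (Or.inr (Or.inl ⟨hε.le, by linarith⟩))
    · have hj' : 1 - ε / 2 ≤ s 0 := by linarith [min_le_right δ' (ε / 2)]
      rw [flatten_of_half_le hε hj', hM1]
      exact hcons _ _ _ (Or.inr (Or.inr ⟨by linarith, by linarith⟩))
  · rw [hMc]
    · exact hcons _ _ _ (flatten_near hε hε')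
    · exact collar_mono (min_le_left _ _) ⟨j, hj⟩

/-- Injectivity in dimension `n` yields some lift `g₀` with the right boundary values; surjectivity
in dimension `n + 1` modifies it inside the cube until `φ ∘ g'` is homotopic to `f`. -/
theorem compressible_succ {φ : X → Y} (hφ : DSmooth φ) (hinj : InjOnSpheroids n φ)
    (hsurj : SurjOnSpheroids (n + 1) φ) : Compressible (n + 1) φ := by
  intro ε g f hε hε' hg hnear hf hfg
  obtain ⟨g₀, hg₀, δ, hδ, h⟩ := hinj.exists_extension hφ hε hε' hg hnear hf hfg
  obtain ⟨g', hg', ⟨δ', hδ', h'⟩, H⟩ := hsurj.exists_homotopicRel hφ hg₀ hf (lt_min hε hδ)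
    fun s hs => by
      rw [hfg s (collar_mono (min_le_left _ _) hs), h s (collar_mono (min_le_right _ _) hs)]
  exact ⟨g', hg', ⟨min δ δ', lt_min hδ hδ', fun s hs => by
    rw [h' s (collar_mono (min_le_right _ _) hs), h s (collar_mono (min_le_left _ _) hs)]⟩, H⟩

end Spheroids

/-! ### Flattening maps on cubes -/

section Cube

variable {n : ℕ} {ε : ℝ}

/-- Flattening all coordinates retracts `ℝ ^ n` to the cube, up to a collar. -/
noncomputable def toCube (hε : 0 < ε ∧ ε ≤ 1 / 4) (s : EuclideanSpace ℝ (Fin n)) : cube n :=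
  ⟨WithLp.toLp 2 fun j => flatten ε (s j), fun _ => flatten_mem hε.1 hε.2⟩

@[simp]
theorem toCube_apply (hε : 0 < ε ∧ ε ≤ 1 / 4) (s : EuclideanSpace ℝ (Fin n)) (j : Fin n) :
    (toCube hε s).1 j = flatten ε (s j) := rfl

@[fun_prop]
theorem dSmooth_toCube (hε : 0 < ε ∧ ε ≤ 1 / 4) : DSmooth (toCube (n := n) hε) :=
  DSmooth.subtype_mk (dSmooth_euclidean_iff.2 fun j =>
    (dSmooth_flatten (ε := ε)).comp (DSmooth.euclidean_apply dSmooth_id j)) _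

theorem toCube_mem_boundary (hε : 0 < ε ∧ ε ≤ 1 / 4) {s : EuclideanSpace ℝ (Fin n)}
    (hs : s ∈ collar n (ε / 2)) : toCube hε s ∈ cubeBoundary n := by
  obtain ⟨j, hj⟩ := hs
  exact ⟨j, hj.imp (fun h => flatten_of_le_half hε.1 hε.2 h.le)
    fun h => flatten_of_half_le hε.1 h.le⟩

theorem toCube_eq_of_near (hε : 0 < ε ∧ ε ≤ 1 / 4) {s s' : EuclideanSpace ℝ (Fin n)}
    (h : Near (ε / 2) s s') : toCube hε s = toCube hε s' := by
  ext j
  exact flatten_eq_of_near hε.1 hε.2 (h j)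

theorem toCube_near (hε : 0 < ε ∧ ε ≤ 1 / 4) (s : EuclideanSpace ℝ (Fin n)) :
    Near ε (toCube hε s).1 s := fun _ => flatten_near hε.1 hε.2

theorem mem_collar_of_mem_boundary {s : cube n} (hs : s ∈ cubeBoundary n) {ε : ℝ} (hε : 0 < ε) :
    s.1 ∈ collar n ε := by
  obtain ⟨j, hj⟩ := hs
  exact ⟨j, hj.imp (fun h => by rw [h]; exact hε) fun h => by rw [h]; linarith⟩

theorem toCube_mem_boundary_of_mem (hε : 0 < ε ∧ ε ≤ 1 / 4) {s : cube n}
    (hs : s ∈ cubeBoundary n) : toCube hε s.1 ∈ cubeBoundary n :=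
  toCube_mem_boundary hε (mem_collar_of_mem_boundary hs (half_pos hε.1))

theorem combo_mem {x y t : ℝ} (hx : x ∈ Set.Icc (0 : ℝ) 1) (hy : y ∈ Set.Icc (0 : ℝ) 1)
    (ht : t ∈ Set.Icc (0 : ℝ) 1) : (1 - t) * x + t * y ∈ Set.Icc (0 : ℝ) 1 := by
  obtain ⟨h1, h2⟩ := hx
  obtain ⟨h3, h4⟩ := hy
  obtain ⟨h5, h6⟩ := ht
  constructor
  · exact add_nonneg (mul_nonneg (by linarith) h1) (mul_nonneg h5 h3)
  · nlinarith

/-- The linear homotopy from the identity of the cube to `toCube`. -/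
noncomputable def cubeHomotopy (hε : 0 < ε ∧ ε ≤ 1 / 4) (z : cube n × unitInterval) : cube n :=
  ⟨WithLp.toLp 2 fun j => (1 - (z.2 : ℝ)) * z.1.1 j + z.2 * flatten ε (z.1.1 j),
    fun j => combo_mem (z.1.2 j) (flatten_mem hε.1 hε.2) z.2.2⟩

@[simp]
theorem cubeHomotopy_apply (hε : 0 < ε ∧ ε ≤ 1 / 4) (z : cube n × unitInterval) (j : Fin n) :
    (cubeHomotopy hε z).1 j = (1 - (z.2 : ℝ)) * z.1.1 j + z.2 * flatten ε (z.1.1 j) := rfl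

@[fun_prop]
theorem dSmooth_cubeHomotopy (hε : 0 < ε ∧ ε ≤ 1 / 4) : DSmooth (cubeHomotopy (n := n) hε) :=
  DSmooth.subtype_mk (dSmooth_euclidean_iff.2 fun j => by
    change DSmooth fun z : cube n × unitInterval =>
      (1 - (z.2 : ℝ)) * z.1.1 j + z.2 * flatten ε (z.1.1 j)
    fun_prop) _

theorem cubeHomotopy_zero (hε : 0 < ε ∧ ε ≤ 1 / 4) (s : cube n) :
    cubeHomotopy hε (s, 0) = s := by
  ext j; simp

theorem cubeHomotopy_one (hε : 0 < ε ∧ ε ≤ 1 / 4) (s : cube n) :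
    cubeHomotopy hε (s, 1) = toCube hε s.1 := by
  ext j; simp

theorem cubeHomotopy_mem_boundary (hε : 0 < ε ∧ ε ≤ 1 / 4) {s : cube n} (hs : s ∈ cubeBoundary n)
    (t : unitInterval) : cubeHomotopy hε (s, t) ∈ cubeBoundary n := by
  obtain ⟨j, hj⟩ := hs
  refine ⟨j, hj.imp (fun h => ?_) fun h => ?_⟩
  · simp [h, flatten_zero hε.1 hε.2]
  · simp [h, flatten_one hε.1]

theorem cubeHomotopy_near (hε : 0 < ε ∧ ε ≤ 1 / 4) (s : cube n) (t : unitInterval) :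
    Near ε (cubeHomotopy hε (s, t)).1 s.1 := fun j => by
  rw [cubeHomotopy_apply]
  have h0 := t.2.1
  have h1 := t.2.2
  rcases flatten_near (t := s.1 j) hε.1 hε.2 with h | ⟨h, h'⟩ | ⟨h, h'⟩
  · left
    rw [h]
    ring
  · exact Or.inr (Or.inl ⟨by dsimp only; nlinarith, h'⟩)
  · exact Or.inr (Or.inr ⟨by dsimp only; nlinarith, h'⟩)

/-- The smooth transition function as a map to the unit interval. -/
noncomputable def stepI (t : ℝ) : unitInterval :=
  ⟨step t, Real.smoothTransition.nonneg t, Real.smoothTransition.le_one t⟩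

@[fun_prop]
theorem dSmooth_stepI : DSmooth stepI := DSmooth.subtype_mk dSmooth_step _

theorem stepI_of_nonpos {t : ℝ} (h : t ≤ 0) : stepI t = 0 :=
  Subtype.ext (Real.smoothTransition.zero_of_nonpos h)

theorem stepI_of_one_le {t : ℝ} (h : 1 ≤ t) : stepI t = 1 :=
  Subtype.ext (Real.smoothTransition.one_of_one_le h)

@[simp]
theorem stepI_zero : stepI 0 = 0 := stepI_of_nonpos le_rfl

@[simp]
theorem stepI_one : stepI 1 = 1 := stepI_of_one_le le_rfl

theorem quarter : (0 : ℝ) < 1 / 4 ∧ (1 / 4 : ℝ) ≤ 1 / 4 := by norm_num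

end Cube

/-! ### Homotopy groups and spheroids -/

section HomotopyGroups

variable {n : ℕ} {X : Type u} {Y : Type v} [DiffeologicalSpace X] [DiffeologicalSpace Y]

/-- The straight-line homotopy to the flattening maps a thin collar into the collar of width `ε`,
where `b` is constant. -/
theorem homotopicRel_toCube {b : EuclideanSpace ℝ (Fin n) → X} (hb : DSmooth b) {x : X} {ε : ℝ}
    (hε : 0 < ε) (hx : ∀ s ∈ collar n ε, b s = x) :
    HomotopicRel b (fun s => b (toCube quarter s).1) := by
  let Λ : EuclideanSpace ℝ (Fin n) × ℝ → EuclideanSpace ℝ (Fin n) := fun z =>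
    WithLp.toLp 2 fun j => (1 - step z.2) * z.1 j + step z.2 * flatten (1 / 4) (z.1 j)
  have hΛ : DSmooth Λ := dSmooth_euclidean_iff.2 fun j => by
    change DSmooth fun z : EuclideanSpace ℝ (Fin n) × ℝ =>
      (1 - step z.2) * z.1 j + step z.2 * flatten (1 / 4) (z.1 j)
    fun_prop
  refine ⟨fun z => b (Λ z), by fun_prop, fun s => congrArg b ?_, fun s => congrArg b ?_,
    min ε (1 / 8), lt_min hε (by norm_num), fun s hs t => ?_⟩
  · ext j; simp [Λ, Real.smoothTransition.zero]
  · ext j; simp [Λ, Real.smoothTransition.one]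
  · rw [hx s (collar_mono (min_le_left _ _) hs)]
    refine hx _ ?_
    obtain ⟨j, hj⟩ := hs
    have h0 := Real.smoothTransition.nonneg t
    have h1 := Real.smoothTransition.le_one t
    have h2 := min_le_left ε (1 / 8)
    have h3 := min_le_right ε (1 / 8)
    refine ⟨j, hj.imp (fun h => ?_) fun h => ?_⟩
    · change (1 - step t) * s j + step t * flatten (1 / 4) (s j) < ε
      rw [flatten_of_le_half quarter.1 quarter.2 (by linarith)]
      rcases le_total (s j) 0 with h' | h' <;> nlinarith
    · change 1 - ε < (1 - step t) * s j + step t * flatten (1 / 4) (s j)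
      rw [flatten_of_half_le quarter.1 (by linarith)]
      rcases le_total (s j) 1 with h' | h' <;> nlinarith

theorem PairHomotopic.homotopicRel {x : X} {f g : cube n → X}
    (H : PairHomotopic (cubeBoundary n) {x} f g) :
    HomotopicRel (fun s => f (toCube quarter s)) (fun s => g (toCube quarter s)) := by
  obtain ⟨H, hH, h0, h1, hb⟩ := H
  refine ⟨fun z => H (toCube quarter z.1, stepI z.2), by fun_prop, fun s => by simp [h0],
    fun s => by simp [h1], 1 / 4 / 2, by norm_num, fun s hs t => ?_⟩
  have hs' := toCube_mem_boundary quarter hs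
  beta_reduce
  rw [← h0, show H (toCube quarter s, 0) = x from hb _ hs' 0]
  exact hb _ hs' _

/-- The restriction to the cube of a map that is constant on a collar. -/
def PairMap.ofSpheroid {b : EuclideanSpace ℝ (Fin n) → X} (hb : DSmooth b) {x : X} {ε : ℝ}
    (hε : 0 < ε) (hx : ∀ s ∈ collar n ε, b s = x) : PairMap (cubeBoundary n) ({x} : Set X) :=
  ⟨fun s => b s.1, hb.comp dSmooth_val, fun _ hs => hx _ (mem_collar_of_mem_boundary hs hε)⟩

/-- The spheroid corresponding to a map of pairs. -/
noncomputable def PairMap.spheroid {x : X} (a : PairMap (cubeBoundary n) ({x} : Set X))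
    (s : EuclideanSpace ℝ (Fin n)) : X := a.1 (toCube quarter s)

theorem PairMap.dSmooth_spheroid {x : X} (a : PairMap (cubeBoundary n) ({x} : Set X)) :
    DSmooth a.spheroid := a.2.1.comp (dSmooth_toCube _)

theorem PairMap.spheroid_eq {x : X} (a : PairMap (cubeBoundary n) ({x} : Set X)) :
    ∀ s ∈ collar n (1 / 4 / 2), a.spheroid s = x := fun _ hs =>
  a.2.2 (toCube_mem_boundary quarter hs)

/-- The class of a map of pairs in `π_n(X, x)`. -/
def HomotopyGrp.mk {x : X} (a : PairMap (cubeBoundary n) ({x} : Set X)) : HomotopyGrp n x :=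
  Quot.mk _ a

theorem HomotopyGrp.mk_eq_ofSpheroid {x : X} (a : PairMap (cubeBoundary n) ({x} : Set X)) :
    mk a = mk (PairMap.ofSpheroid a.dSmooth_spheroid (by norm_num) a.spheroid_eq) := by
  refine Quot.sound ⟨fun z => a.1 (cubeHomotopy quarter z), a.2.1.comp (dSmooth_cubeHomotopy _),
    fun s => by simp [cubeHomotopy_zero],
    fun s => by simp [cubeHomotopy_one, PairMap.ofSpheroid, PairMap.spheroid],
    fun s hs t => a.2.2 (cubeHomotopy_mem_boundary quarter hs t)⟩

/-- Equality in `Quot` only provides a zigzag of homotopies; `HomotopicRel` absorbs it, being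
symmetric and transitive. -/
theorem HomotopyGrp.mk_eq_iff {x : X} {a b : PairMap (cubeBoundary n) ({x} : Set X)} :
    mk a = mk b ↔ HomotopicRel a.spheroid b.spheroid := by
  constructor
  · intro h
    have h' := Quot.eqvGen_exact h
    clear h
    induction h' with
    | rel a b h => exact h.homotopicRel
    | refl a => exact HomotopicRel.refl a.dSmooth_spheroid
    | symm _ _ _ ih => exact ih.symm
    | trans _ _ _ _ _ ih ih' => exact ih.trans ih'
  · rintro ⟨M, hM, hM0, hM1, ε, hε, hc⟩
    rw [mk_eq_ofSpheroid a, mk_eq_ofSpheroid b]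
    refine Quot.sound ⟨fun z => M (z.1.1, z.2), by fun_prop, fun s => hM0 _, fun s => hM1 _,
      fun s hs t => ?_⟩
    simp only [hc s.1 (mem_collar_of_mem_boundary hs hε)]
    exact a.spheroid_eq _ (mem_collar_of_mem_boundary hs (by norm_num))

theorem PairMap.homotopicRel_ofSpheroid {b : EuclideanSpace ℝ (Fin n) → X} (hb : DSmooth b)
    {x : X} {ε : ℝ} (hε : 0 < ε) (hx : ∀ s ∈ collar n ε, b s = x) :
    HomotopicRel b (PairMap.ofSpheroid hb hε hx).spheroid := homotopicRel_toCube hb hε hx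

theorem HomotopyGrp.injOnSpheroids {φ : X → Y} (hφ : DSmooth φ)
    (h : ∀ x, Function.Injective (HomotopyGrp.map n x φ hφ)) : InjOnSpheroids n φ := by
  intro x a b ha hb ε hε hax hbx H
  have Ha := PairMap.homotopicRel_ofSpheroid ha hε hax
  have Hb := PairMap.homotopicRel_ofSpheroid hb hε hbx
  have : mk (PairMap.ofSpheroid ha hε hax) = mk (PairMap.ofSpheroid hb hε hbx) :=
    h x (mk_eq_iff.2 (((Ha.comp hφ).symm.trans H).trans (Hb.comp hφ)))
  exact (Ha.trans (mk_eq_iff.1 this)).trans Hb.symm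

theorem HomotopyGrp.surjOnSpheroids {φ : X → Y} (hφ : DSmooth φ)
    (h : ∀ x, Function.Surjective (HomotopyGrp.map n x φ hφ)) : SurjOnSpheroids n φ := by
  intro x b hb ε hε hbx
  obtain ⟨⟨a⟩, ha⟩ := h x (mk (PairMap.ofSpheroid hb hε hbx))
  exact ⟨a.spheroid, a.dSmooth_spheroid, ⟨_, by norm_num, a.spheroid_eq⟩,
    (mk_eq_iff.1 ha).trans (PairMap.homotopicRel_ofSpheroid hb hε hbx).symm⟩

/-- A reformulation of `N`-equivalences in terms of spheroids. -/
structure IsSpheroidEquivalence (N : ℕ) (φ : X → Y) : Prop where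
  dSmooth : DSmooth φ
  joined : 0 < N → ∀ y, ∃ x, SmoothlyJoined (φ x) y
  inj : ∀ n < N, InjOnSpheroids n φ
  surj : ∀ n < N, SurjOnSpheroids n φ

theorem IsNEquivalence.isSpheroidEquivalence {N : ℕ} {φ : X → Y} (h : IsNEquivalence N φ) :
    IsSpheroidEquivalence N φ := by
  obtain ⟨hφ, h0, h⟩ := h
  exact ⟨hφ, h0, fun n hn => HomotopyGrp.injOnSpheroids hφ fun x => (h x n hn).1,
    fun n hn => HomotopyGrp.surjOnSpheroids hφ fun x => (h x n hn).2⟩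

/-- `ℝ ^ 0` is a point with empty collar, so compressing means joining `f 0` to the image of `φ`. -/
theorem compressible_zero {φ : X → Y} (h : ∀ y, ∃ x, SmoothlyJoined (φ x) y) :
    Compressible 0 φ := by
  intro ε g f _ _ _ _ hf _
  obtain ⟨x, γ, hγ, h0, h1⟩ := h (f 0)
  refine ⟨fun _ => x, dSmooth_const, ⟨1, one_pos, fun s ⟨j, _⟩ => j.elim0⟩,
    fun z => γ (stepI (1 - z.2)), by fun_prop, fun s => ?_, fun s => ?_, 1, one_pos,
    fun s ⟨j, _⟩ => j.elim0⟩
  · simp [h1, Subsingleton.elim s 0]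
  · simp [h0]

theorem IsSpheroidEquivalence.compressible {N : ℕ} {φ : X → Y} (h : IsSpheroidEquivalence N φ)
    {n : ℕ} (hn : n < N) : Compressible n φ := by
  cases n with
  | zero => exact compressible_zero (h.joined hn)
  | succ n => exact compressible_succ h.dSmooth (h.inj n (by omega)) (h.surj _ hn)

/-! ### Self-maps homotopic to the identity, and right homotopy inverses. -/

variable {θ : X → X}

theorem Homotopic.homotopicAlong_id (hθ : Homotopic θ id) :
    ∃ K : X × ℝ → X, DSmooth K ∧ (∀ x, K (x, 0) = θ x) ∧ ∀ x, K (x, 1) = x := by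
  obtain ⟨H, hH, h0, h1⟩ := hθ
  exact ⟨fun z => H (z.1, stepI z.2), by fun_prop, fun x => by simp [h0], fun x => by simp [h1]⟩

/-- The homotopy moves `θ ∘ a` to `a` while the base point follows the track `K (x, ·)`; transport
along a common track preserves relative homotopy. -/
theorem Homotopic.injOnSpheroids (hθ : Homotopic θ id) : InjOnSpheroids n θ := by
  obtain ⟨K, hK, h0, h1⟩ := hθ.homotopicAlong_id
  intro x a b ha hb ε hε hax hbx H
  have key : ∀ a : EuclideanSpace ℝ (Fin n) → X, DSmooth a → (∀ s ∈ collar n ε, a s = x) →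
      HomotopicAlong (fun z => K (x, z.2)) 0 1 (fun s => θ (a s)) a := fun a ha hax =>
    ⟨fun z => K (a z.1, z.2), id, by fun_prop, contDiff_id, rfl, rfl, fun s => h0 _,
      fun s => h1 _, ε, hε, fun s hs t => by simp [hax s hs]⟩
  exact (key a ha hax).transport (key b hb hbx) H one_pos (DSmooth.smoothOn (by fun_prop) _)

theorem Homotopic.surjOnSpheroids (hθ : Homotopic θ id) : SurjOnSpheroids n θ := by
  obtain ⟨K, hK, h0, h1⟩ := hθ.homotopicAlong_id
  intro x b hb ε hε hbx
  have hs : DSmooth fun z : EuclideanSpace ℝ (Fin n) × ℝ => K (x, z.2) := by fun_prop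
  -- Moving the base point of `b` from `θ x` to `x` along the track gives `a`. Then `θ ∘ a` and `b`
  -- both transport to `a`, hence are homotopic.
  obtain ⟨a, Ha⟩ := exists_homotopicAlong hε (hs.smoothOn _) hb 0 1
    fun s hs => by rw [hbx s hs, h0]
  obtain ⟨δ, hδ, hax⟩ := Ha.exists_right_eq
  have ha := Ha.dSmooth_right
  refine ⟨a, ha, ⟨δ, hδ, fun s hs => by rw [hax s hs, h1]⟩, ?_⟩
  have H : HomotopicAlong (fun z => K (x, z.2)) 0 1 (fun s => θ (a s)) a :=
    ⟨fun z => K (a z.1, z.2), id, by fun_prop, contDiff_id, rfl, rfl, fun s => h0 _,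
      fun s => h1 _, δ, hδ, fun s hs t => by simp [hax s hs, h1]⟩
  exact H.symm.transport Ha.symm (HomotopicRel.refl ha) one_pos (hs.smoothOn _)

/-- A smooth right homotopy inverse of an `N`-equivalence is an `N`-equivalence. -/
theorem IsSpheroidEquivalence.of_rightInverse {N : ℕ} {φ : X → Y} {ψ : Y → X}
    (h : IsSpheroidEquivalence N φ) (hψ : DSmooth ψ) (H : Homotopic (φ ∘ ψ) id) :
    IsSpheroidEquivalence N ψ := by
  have hsurj : ∀ n < N, SurjOnSpheroids n ψ := by
    intro n hn y b hb ε hε hby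
    -- Surjectivity of `φ ∘ ψ` gives `φ ∘ ψ ∘ a ≃ φ ∘ b`, from which injectivity of `φ` cancels `φ`.
    obtain ⟨a, ha, ⟨δ, hδ, hay⟩, hab⟩ := H.surjOnSpheroids y (fun s => φ (b s)) (h.dSmooth.comp hb)
      ε hε fun s hs => by simp [hby s hs]
    refine ⟨a, ha, ⟨δ, hδ, hay⟩, h.inj n hn (ψ y) _ b (hψ.comp ha) hb (min δ ε) (lt_min hδ hε)
      (fun s hs => ?_) (fun s hs => hby s (collar_mono (min_le_right _ _) hs)) hab⟩
    rw [hay s (collar_mono (min_le_left _ _) hs)]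
  refine ⟨hψ, fun hN x => ?_, fun n hn y a b ha hb ε hε hay hby hab => ?_, hsurj⟩
  -- A `0`-dimensional spheroid has no boundary condition, so the base point `φ x` serves only to
  -- show that `Y` is nonempty.
  · obtain ⟨a, ha, -, M, hM, h0, h1, -⟩ := hsurj 0 hN (φ x) (fun _ => x) dSmooth_const 1 one_pos
      fun s ⟨j, _⟩ => j.elim0
    exact ⟨a 0, fun t => M (0, t), by fun_prop, by simp [h0], by simp [h1]⟩
  · have hab' := hab.comp h.dSmooth
    exact H.injOnSpheroids y a b ha hb ε hε hay hby hab'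

end HomotopyGroups

/-! ### Extension of lifts and homotopies over a cell -/

section Cell

variable {n : ℕ} {X : Type*} {Y : Type*} [DiffeologicalSpace X] [DiffeologicalSpace Y]

/-- Flattening, as a map from the real line to the unit interval. -/
noncomputable def flattenI {δ : ℝ} (hδ : 0 < δ ∧ δ ≤ 1 / 4) (t : ℝ) : unitInterval :=
  ⟨flatten δ t, flatten_mem hδ.1 hδ.2⟩

@[fun_prop]
theorem dSmooth_flattenI {δ : ℝ} (hδ : 0 < δ ∧ δ ≤ 1 / 4) : DSmooth (flattenI hδ) :=
  DSmooth.subtype_mk dSmooth_flatten _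

/-- A homotopy that starts with a flattened map can be preceded by the flattening homotopy. -/
theorem exists_prepend_cubeHomotopy {f : cube n → Y} (hf : DSmooth f)
    {M : EuclideanSpace ℝ (Fin n) × ℝ → Y} (hM : DSmooth M) {ε δ : ℝ}
    (hε : 0 < ε ∧ ε ≤ 1 / 4) (hδ : 0 < δ ∧ δ ≤ 1 / 4) (hM0 : ∀ s, M (s, 0) = f (toCube hε s)) :
    ∃ K : cube n × unitInterval → Y, DSmooth K ∧
      (∀ s (t : unitInterval), (t : ℝ) < δ / 2 →
        K (s, t) = f (cubeHomotopy hε (s, stepI (8 / δ * t - 1)))) ∧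
      ∀ s (t : unitInterval), δ / 4 < (t : ℝ) → K (s, t) = M (s.1, flatten δ t) := by
  classical
  -- `K₁` is stationary up to time `δ / 8` and has reached the flattened map by `δ / 4`, while `K₂`
  -- stays at `M (·, 0)` until `δ / 2`; they agree in between.
  let K₁ : cube n × unitInterval → Y := fun z =>
    f (cubeHomotopy hε (z.1, stepI (8 / δ * z.2 - 1)))
  let K₂ : cube n × unitInterval → Y := fun z => M (z.1.1, flatten δ z.2)
  have hK₁ : DSmooth K₁ := by fun_prop
  have hK₂ : DSmooth K₂ := by fun_prop
  have e : ∀ t : ℝ, 8 / δ * t = t / δ * 8 := fun t => by ring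
  have key : ∀ z : cube n × unitInterval, δ / 4 < (z.2 : ℝ) → (z.2 : ℝ) < δ / 2 → K₁ z = K₂ z := by
    intro z h1 h2
    have : 1 / 4 ≤ (z.2 : ℝ) / δ := by rw [le_div_iff₀ hδ.1]; linarith
    simp only [K₁, K₂]
    rw [stepI_of_one_le (by rw [e]; linarith), cubeHomotopy_one,
      flatten_of_le_half hδ.1 hδ.2 h2.le, hM0]
  let K : cube n × unitInterval → Y := fun z => if (z.2 : ℝ) < δ / 3 then K₁ z else K₂ z
  have h1 : ∀ z : cube n × unitInterval, (z.2 : ℝ) < δ / 2 → K z = K₁ z := by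
    intro z hz
    by_cases h : (z.2 : ℝ) < δ / 3
    · exact if_pos h
    · exact (if_neg h).trans (key z (by linarith [hδ.1]) hz).symm
  have h2 : ∀ z : cube n × unitInterval, δ / 4 < (z.2 : ℝ) → K z = K₂ z := by
    intro z hz
    by_cases h : (z.2 : ℝ) < δ / 3
    · exact (if_pos h).trans (key z hz (by linarith [hδ.1]))
    · exact if_neg h
  refine ⟨K, ?_, fun s t ht => h1 (s, t) ht, fun s t ht => h2 (s, t) ht⟩
  refine DSmooth.glue (π := fun z : cube n × unitInterval => (z.2 : ℝ)) (U₁ := Set.Iio (δ / 2))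
    (U₂ := Set.Ioi (δ / 4)) (DSmooth.continuous_comp_isPlot (by fun_prop)) isOpen_Iio isOpen_Ioi
    ?_ ((hK₁.smoothOn _).congr h1) ((hK₂.smoothOn _).congr h2)
  ext x
  simp only [Set.mem_union, Set.mem_Iio, Set.mem_Ioi, Set.mem_univ, iff_true]
  by_contra! hx
  linarith [hδ.1]

/-- Composition with `toCube` spreads `g` and `k` over a collar. Push `f ∘ toCube` along the spread
`k` to a map `f₁` that lifts on the collar, and compress `f₁`. As this starts from `f ∘ toCube`
instead of `f`, the flattening homotopy is put in front; by tameness it is invisible on the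
boundary. This extra stage shrinks the stationary time from `δ` to `δ / 8`. -/
theorem exists_cell_extension [Nonempty X] {φ : X → Y} (hc : Compressible n φ)
    {f : cube n → Y} (hf : DSmooth f) {g : cubeBoundary n → X} (hg : DSmooth g)
    {k : cubeBoundary n × unitInterval → Y} (hk : DSmooth k) {ε δ : ℝ}
    (hε : 0 < ε ∧ ε ≤ 1 / 4) (hδ : 0 < δ ∧ δ ≤ 1 / 4)
    (htame : ∀ s s' : cubeBoundary n, Near ε s.1.1 s'.1.1 → g s = g s' ∧ ∀ t, k (s, t) = k (s', t))
    (htime : ∀ s (t t' : unitInterval), RNear δ t t' → k (s, t) = k (s, t'))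
    (h0 : ∀ s, k (s, 0) = f s.1) (h1 : ∀ s, k (s, 1) = φ (g s)) :
    ∃ (g' : cube n → X) (K : cube n × unitInterval → Y), DSmooth g' ∧ DSmooth K ∧
      (∀ s : cubeBoundary n, g' s.1 = g s) ∧ (∀ s, K (s, 0) = f s) ∧
      (∀ s, K (s, 1) = φ (g' s)) ∧ (∀ (s : cubeBoundary n) t, K (s.1, t) = k (s, t)) ∧
      ∀ s (t t' : unitInterval), RNear (δ / 8) t t' → K (s, t) = K (s, t') := by
  classical
  -- Only the values on the collar matter. The default is used where `toCube` lands in the open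
  -- cube.
  let G : EuclideanSpace ℝ (Fin n) → X := fun s =>
    if h : toCube hε s ∈ cubeBoundary n then g ⟨_, h⟩ else Classical.arbitrary X
  have hG : ∀ s (h : toCube hε s ∈ cubeBoundary n), G s = g ⟨_, h⟩ := fun s h => dif_pos h
  have hGs : SmoothOn G (collar n (ε / 2)) := smoothOn_of_subtype <| by
    rw [show (fun s : collar n (ε / 2) => G s) =
      fun s => g ⟨toCube hε s.1, toCube_mem_boundary hε s.2⟩ from
        funext fun s => hG _ (toCube_mem_boundary hε s.2)]
    exact hg.comp (DSmooth.subtype_mk ((dSmooth_toCube hε).comp dSmooth_val) _)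
  let h : EuclideanSpace ℝ (Fin n) × ℝ → Y := fun z =>
    if h : toCube hε z.1 ∈ cubeBoundary n then k (⟨_, h⟩, flattenI hδ z.2) else f (toCube hε z.1)
  have hh : ∀ s t (h' : toCube hε s ∈ cubeBoundary n), h (s, t) = k (⟨_, h'⟩, flattenI hδ t) :=
    fun s t h => dif_pos h
  have hhs : SmoothOn h (collar n (ε / 2) ×ˢ Set.univ) := smoothOn_of_subtype <| by
    rw [show (fun z : (collar n (ε / 2) ×ˢ Set.univ : Set (EuclideanSpace ℝ (Fin n) × ℝ)) => h z) =
      fun z => k (⟨toCube hε z.1.1, toCube_mem_boundary hε z.2.1⟩, flattenI hδ z.1.2) from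
        funext fun z => hh _ _ (toCube_mem_boundary hε z.2.1)]
    refine hk.comp (DSmooth.prodMk (DSmooth.subtype_mk ?_ _) ?_)
    · fun_prop
    · fun_prop
  have fl0 : flattenI hδ 0 = 0 := Subtype.ext (flatten_zero hδ.1 hδ.2)
  have fl1 : flattenI hδ 1 = 1 := Subtype.ext (flatten_one hδ.1)
  have hε2 : 0 < ε / 2 := half_pos hε.1
  obtain ⟨f₁, H₁⟩ := exists_homotopicAlong (a := fun s => f (toCube hε s)) hε2 hhs (by fun_prop)
    0 1 fun s hs => by rw [hh s 0 (toCube_mem_boundary hε hs), fl0, h0]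
  obtain ⟨ε₁, hε₁, hf₁⟩ := H₁.exists_right_eq
  obtain ⟨g', hg', ⟨ε₂, hε₂, hg'G⟩, H₂⟩ := hc (min ε₁ (ε / 2)) G f₁ (lt_min hε₁ hε2)
    ((min_le_right _ _).trans (by linarith [hε.2])) (hGs.mono (collar_mono (min_le_right _ _)))
    (fun s s' hss => by
      have : toCube hε s = toCube hε s' :=
        toCube_eq_of_near hε fun j => (hss j).mono (min_le_right _ _)
      simp only [G, this])
    H₁.dSmooth_right fun s hs => by
      have hs' := toCube_mem_boundary hε (collar_mono (min_le_right ε₁ (ε / 2)) hs)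
      rw [hf₁ s (collar_mono (min_le_left _ _) hs), hh s 1 hs', fl1, h1, hG s hs']
  obtain ⟨M, hM, hM0, hM1, ε₃, hε₃, hMh⟩ :=
    (H₁.trans_rel H₂).exists_homotopy hε2 hhs contDiff_id rfl rfl
  obtain ⟨K, hK, hK1, hK2⟩ := exists_prepend_cubeHomotopy hf hM hε hδ hM0
  have e : ∀ t : ℝ, 8 / δ * t = t / δ * 8 := fun t => by ring
  have hgs : ∀ s : cubeBoundary n, g' s.1.1 = g s := fun s => by
    rw [hg'G _ (mem_collar_of_mem_boundary s.2 hε₂), hG _ (toCube_mem_boundary_of_mem hε s.2)]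
    exact (htame _ _ (toCube_near hε _)).1
  refine ⟨fun s => g' s.1, K, by fun_prop, hK, hgs, fun s => ?_, fun s => ?_, fun s t => ?_,
    fun s t t' htt => ?_⟩
  · rw [hK1 s 0 (by simpa using hδ.1), stepI_of_nonpos (by simp), cubeHomotopy_zero]
  · rw [hK2 s 1 (by simpa using by linarith [hδ.2]), show flatten δ (1 : unitInterval) = 1 from
      flatten_one hδ.1, hM1]
  · by_cases ht : (t : ℝ) < δ / 2
    · rw [hK1 _ _ ht]
      have hb := cubeHomotopy_mem_boundary hε s.2 (stepI (8 / δ * t - 1))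
      rw [← h0 ⟨_, hb⟩, (htame ⟨_, hb⟩ s (cubeHomotopy_near hε _ _)).2]
      exact htime _ _ _ (Or.inr (Or.inl ⟨hδ.1.le, by linarith [hδ.1]⟩))
    · rw [hK2 _ _ (by linarith [hδ.1]), hMh _ (mem_collar_of_mem_boundary s.2 hε₃),
        hh _ _ (toCube_mem_boundary_of_mem hε s.2), (htame _ s (toCube_near hε _)).2,
        htime s _ (flattenI hδ t) (flatten_near hδ.1 hδ.2)]
      exact htime _ _ _ (flatten_near hδ.1 hδ.2)
  · rcases htt with htt | ⟨h1, h2⟩ | ⟨h1, h2⟩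
    · rw [Subtype.ext htt]
    · have e' : ∀ t : unitInterval, (t : ℝ) ≤ δ / 8 → stepI (8 / δ * t - 1) = 0 := fun t ht => by
        have : (t : ℝ) / δ ≤ 1 / 8 := by rw [div_le_iff₀ hδ.1]; linarith
        exact stepI_of_nonpos (by rw [e]; linarith)
      rw [hK1 _ _ (by linarith [hδ.1]), hK1 _ _ (by linarith [hδ.1]), e' _ h1, e' _ h2]
    · rw [hK2 _ _ (by linarith [hδ.1, hδ.2]), hK2 _ _ (by linarith [hδ.1, hδ.2]),
        flatten_of_half_le hδ.1 (by linarith [hδ.1]), flatten_of_half_le hδ.1 (by linarith [hδ.1])]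

end Cell

/-! ### Cells of a smooth CW complex -/

section Pushout

variable {n : ℕ} {Λ : Type*} {B : Type*} {P : Type*} [DiffeologicalSpace B] [DiffeologicalSpace P]
  {inc : B → P} {att : Λ → cubeBoundary n → B} {char : Λ → cube n → P}

theorem IsCellPushout.char_eq (h : IsCellPushout inc att char) (l : Λ) (t : cubeBoundary n) :
    char l t.1 = inc (att l t) :=
  ((h.eq_iff (Sum.inl (att l t)) (Sum.inr (l, t.1))).2 (.rel _ _ ⟨l, t, rfl, rfl⟩)).symm

/-- The generating identifications involve only boundary points of cubes, so the class of an
interior point is a singleton. -/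
theorem IsCellPushout.eq_of_eq (h : IsCellPushout inc att char) {a : B ⊕ (Λ × cube n)} {l : Λ}
    {t : cube n} (ht : t ∉ cubeBoundary n)
    (ha : Sum.elim inc (fun c : Λ × cube n => char c.1 c.2) a = char l t) : a = Sum.inr (l, t) := by
  have key : ∀ a b : B ⊕ (Λ × cube n), Relation.EqvGen
      (fun x y => ∃ (l : Λ) (t : cubeBoundary n), x = Sum.inl (att l t) ∧ y = Sum.inr (l, t.1)) a b →
      (a = Sum.inr (l, t) ↔ b = Sum.inr (l, t)) := by
    intro a b hab
    induction hab with
    | rel a b hab =>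
      obtain ⟨l', t', rfl, rfl⟩ := hab
      simp only [reduceCtorEq, Sum.inr.injEq, Prod.mk.injEq, false_iff, not_and]
      rintro - rfl
      exact ht t'.2
    | refl a => rfl
    | symm _ _ _ ih => exact ih.symm
    | trans _ _ _ _ _ ih ih' => exact ih.trans ih'
  exact (key _ _ ((h.eq_iff a (Sum.inr (l, t))).1 ha)).2 rfl

theorem IsCellPushout.dSmooth_char (h : IsCellPushout inc att char) (l : Λ) : DSmooth (char l) :=
  fun _ q hq => (h.isPlot_iff _).2 fun _ => Or.inr ⟨l, q, hq, Filter.EventuallyEq.rfl⟩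

end Pushout

section Cells

open scoped ContDiff

variable {X : Type u} [DiffeologicalSpace X] (c : CWComplex.{u, w} X)

/-- The characteristic map of a cell, as a map into the whole complex. -/
def RelCWComplex.toFun {X : Type u} [DiffeologicalSpace X] {A : Set X} (c : RelCWComplex.{u, w} X A)
    (n : ℕ) (l : c.cell n) (t : cube n) : X := c.charMap n l t

namespace RelCWComplex

theorem skel_mono : Monotone c.skel := monotone_nat_of_le_succ c.skel_subset

theorem toFun_boundary {n : ℕ} (l : c.cell n) (t : cubeBoundary n) :
    c.toFun n l t.1 = c.attachMap n l t := by
  rw [toFun, (c.isPushout n).char_eq]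

theorem toFun_mem_skel {n : ℕ} (l : c.cell n) {t : cube n} (ht : t ∈ cubeBoundary n) :
    c.toFun n l t ∈ c.skel n := by
  rw [c.toFun_boundary l ⟨t, ht⟩]
  exact (c.attachMap n l _).2

theorem toFun_mem_skel_succ {n : ℕ} (l : c.cell n) (t : cube n) : c.toFun n l t ∈ c.skel (n + 1) :=
  (c.charMap n l t).2

theorem dSmooth_toFun {n : ℕ} (l : c.cell n) : DSmooth (c.toFun n l) :=
  dSmooth_val.comp ((c.isPushout n).dSmooth_char l)

theorem toFun_notMem_skel {n : ℕ} (l : c.cell n) {t : cube n} (ht : t ∉ cubeBoundary n) :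
    c.toFun n l t ∉ c.skel n := fun h => by
  have := (c.isPushout n).eq_of_eq (a := Sum.inl ⟨_, h⟩) (l := l) ht (Subtype.ext rfl)
  cases this

theorem toFun_injective {n : ℕ} {l l' : c.cell n} {t t' : cube n} (ht : t ∉ cubeBoundary n)
    (h : c.toFun n l' t' = c.toFun n l t) : l' = l ∧ t' = t := by
  have := (c.isPushout n).eq_of_eq (a := Sum.inr (l', t')) (l := l) ht (Subtype.ext h)
  simpa using this

theorem dim_eq {n m : ℕ} {l : c.cell n} {l' : c.cell m} {t : cube n} {t' : cube m}
    (ht : t ∉ cubeBoundary n) (ht' : t' ∉ cubeBoundary m) (h : c.toFun n l t = c.toFun m l' t') :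
    n = m := by
  rcases lt_trichotomy n m with hnm | hnm | hnm
  · exact absurd (h ▸ c.skel_mono (Nat.succ_le_of_lt hnm) (c.toFun_mem_skel_succ l t))
      (c.toFun_notMem_skel l' ht')
  · exact hnm
  · exact absurd (h ▸ c.skel_mono (Nat.succ_le_of_lt hnm) (c.toFun_mem_skel_succ l' t'))
      (c.toFun_notMem_skel l ht)

theorem mem_skel_succ {n : ℕ} {x : X} (hx : x ∈ c.skel (n + 1)) :
    x ∈ c.skel n ∨ ∃ l t, t ∉ cubeBoundary n ∧ x = c.toFun n l t := by
  obtain ⟨b | ⟨l, t⟩, h⟩ := (c.isPushout n).surjective ⟨x, hx⟩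
  · left
    have h' : (b : X) = x := congrArg Subtype.val h
    exact h' ▸ b.2
  · have h' : c.toFun n l t = x := congrArg Subtype.val h
    by_cases ht : t ∈ cubeBoundary n
    · exact Or.inl (h' ▸ c.toFun_mem_skel l ht)
    · exact Or.inr ⟨l, t, ht, h'.symm⟩

theorem exists_mem_skel (x : X) : ∃ n, x ∈ c.skel n := by
  rw [← Set.mem_iUnion, c.iUnion_skel]
  trivial

theorem exists_cell (x : X) : ∃ n l t, t ∉ cubeBoundary n ∧ x = c.toFun n l t := by
  obtain ⟨n, hn⟩ := c.exists_mem_skel x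
  induction n with
  | zero => rw [c.skel_zero] at hn; exact hn.elim
  | succ n ih =>
    rcases c.mem_skel_succ hn with h | ⟨l, t, h⟩
    · exact ih h
    · exact ⟨n, l, t, h⟩

/-- A cell of positive dimension has nonempty boundary, whose attaching map provides a point in a
lower skeleton. -/
theorem nonempty_cell_zero [Nonempty X] : Nonempty (c.cell 0) := by
  obtain ⟨x⟩ := ‹Nonempty X›
  obtain ⟨n, hn⟩ := c.exists_mem_skel x
  induction n generalizing x with
  | zero => rw [c.skel_zero] at hn; exact hn.elim
  | succ n ih =>
    rcases c.mem_skel_succ hn with h | ⟨l, t, h⟩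
    · exact ih x h
    · cases n with
      | zero => exact ⟨l⟩
      | succ n =>
        let b : cubeBoundary (n + 1) := ⟨⟨0, fun j => by simp⟩, 0, Or.inl rfl⟩
        exact ih _ (c.attachMap _ l b).2

theorem exists_interior_point (n : ℕ) : ∃ t : cube n, t ∉ cubeBoundary n := by
  refine ⟨⟨WithLp.toLp 2 fun _ => 1 / 2, fun j => ?_⟩, ?_⟩
  · norm_num
  · rintro ⟨j, hj⟩
    norm_num at hj

theorem lt_of_dimLT {N : ℕ} (hN : c.DimLT N) {n : ℕ} (hn : Nonempty (c.cell n)) : n < N := by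
  obtain ⟨l⟩ := hn
  obtain ⟨t, ht⟩ := exists_interior_point n
  by_contra! h
  refine c.toFun_notMem_skel l ht (c.skel_mono h ?_)
  rw [show c.skel N = Set.univ from hN]
  trivial

/-! ### Local behaviour of plots with respect to the skeleta. -/

variable {m : ℕ} {p : EuclideanSpace ℝ (Fin m) → X} {r : EuclideanSpace ℝ (Fin m)}

theorem eventually_mem_skel (hp : IsPlot p) (r : EuclideanSpace ℝ (Fin m)) :
    ∃ n, ∀ᶠ r' in 𝓝 r, p r' ∈ c.skel n := by
  obtain ⟨n, q, -, hq⟩ := (c.isPlot_iff p).1 hp r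
  exact ⟨n, hq.mono fun r' h => by rw [h]; exact (q r').2⟩

theorem eventually_mem_skel_succ (hp : IsPlot p) {n : ℕ} (h : ∀ᶠ r' in 𝓝 r, p r' ∈ c.skel (n + 1)) :
    (∀ᶠ r' in 𝓝 r, p r' ∈ c.skel n) ∨
      ∃ (l : c.cell n) (q : EuclideanSpace ℝ (Fin m) → cube n), IsPlot q ∧
        p =ᶠ[𝓝 r] c.toFun n l ∘ q := by
  -- `p` lies in the skeleton only near `r`, whereas plots of the skeleton are global; `p ∘ β` is
  -- such a plot and agrees with `p` near `r`.
  obtain ⟨β, hβ, hβU, hβr⟩ := exists_localization h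
  have hq : IsPlot fun x => (⟨p (β x), hβU x⟩ : c.skel (n + 1)) := isPlot_reparam hp hβ
  rcases ((c.isPushout n).isPlot_iff _).1 hq r with ⟨q, -, h'⟩ | ⟨l, q, hq, h'⟩
  · left
    filter_upwards [hβr, h'] with x hx hx'
    rw [← hx]
    have : p (β x) = (q x : X) := congrArg Subtype.val hx'
    rw [this]
    exact (q x).2
  · refine Or.inr ⟨l, q, hq, ?_⟩
    filter_upwards [hβr, h'] with x hx hx'
    rw [← hx]
    simp only [Function.comp_apply, hx]
    have : p (β x) = c.toFun n l (q x) := congrArg Subtype.val hx'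
    rw [← this, hx]

/-- A set that contains every closed cell whose interior it meets. -/
def IsCellClosed (B : Set X) : Prop :=
  ∀ n l t, t ∉ cubeBoundary n → c.toFun n l t ∈ B → ∀ t', c.toFun n l t' ∈ B

-- A point of `B` lies in an open cell of the subcomplex, which is also an open cell of `X`. Open
-- cells are disjoint, so this is the given cell, and its closed cell lies in `B`.
variable {c} in
theorem IsSubcomplex.isCellClosed {B : Set X} (h : c.IsSubcomplex B) : c.IsCellClosed B := by
  obtain ⟨b, hb⟩ := h
  intro n l t ht htB t'
  obtain ⟨m, l₀, t₀, ht₀, h⟩ := b.exists_cell ⟨_, htB⟩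
  obtain ⟨l', hl'⟩ := hb m l₀
  have h' : c.toFun n l t = c.toFun m l' t₀ := (congrArg Subtype.val h).trans (hl' t₀)
  obtain rfl := c.dim_eq ht ht₀ h'
  obtain ⟨rfl, rfl⟩ := c.toFun_injective ht₀ h'
  rw [show c.toFun n l t' = _ from (hl' t').symm]
  exact Subtype.coe_prop _

theorem isCellClosed_empty : c.IsCellClosed ∅ := fun _ _ _ _ h => h.elim

/-! ### Attaching cells relative to a cell-closed set. -/

variable {c} {B : Set X}

/-- Descend through the skeleta containing `p` near `r`. If `p` factors there through a cell of
dimension at least `n` not contained in `B`, the open cell misses `B ∪ c.skel n`, so `p` runs in the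
cell's boundary and thus in a lower skeleton. -/
theorem IsCellClosed.eventually_mem (hB : c.IsCellClosed B) (hp : IsPlot p) {n : ℕ}
    (h : ∀ r, p r ∈ B ∪ c.skel n) (r : EuclideanSpace ℝ (Fin m)) :
    (∀ᶠ r' in 𝓝 r, p r' ∈ B) ∨ ∀ᶠ r' in 𝓝 r, p r' ∈ c.skel n := by
  obtain ⟨k, hk⟩ := c.eventually_mem_skel hp r
  induction k with
  | zero => exact Or.inr (hk.mono fun r' h' => c.skel_mono (Nat.zero_le _) h')
  | succ k ih =>
    rcases Nat.lt_or_ge k n with hkn | hkn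
    · exact Or.inr (hk.mono fun r' h' => c.skel_mono hkn h')
    rcases c.eventually_mem_skel_succ hp hk with hk | ⟨l, q, hq, hpq⟩
    · exact ih hk
    by_cases hl : ∀ t, c.toFun k l t ∈ B
    · exact Or.inl (hpq.mono fun r' h' => by rw [h']; exact hl _)
    refine ih (hpq.mono fun r' h' => ?_)
    rw [h']
    refine c.toFun_mem_skel l ?_
    by_contra hq'
    have h'' : c.toFun k l (q r') ∈ B ∪ c.skel n := by
      have := h r'
      rwa [h'] at this
    rcases h'' with h'' | h''
    · exact hl (hB k l _ hq' h'')
    · exact c.toFun_notMem_skel l hq' (c.skel_mono hkn h'')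

theorem IsCellClosed.eventually_mem_succ (hB : c.IsCellClosed B) (hp : IsPlot p) {n : ℕ}
    (h : ∀ r, p r ∈ B ∪ c.skel (n + 1)) (r : EuclideanSpace ℝ (Fin m)) :
    (∀ᶠ r' in 𝓝 r, p r' ∈ B ∪ c.skel n) ∨
      ∃ (l : c.cell n) (q : EuclideanSpace ℝ (Fin m) → cube n),
        (¬ ∀ t, c.toFun n l t ∈ B) ∧ IsPlot q ∧ p =ᶠ[𝓝 r] c.toFun n l ∘ q := by
  rcases hB.eventually_mem hp h r with h | h
  · exact Or.inl (h.mono fun _ => Or.inl)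
  rcases c.eventually_mem_skel_succ hp h with h | ⟨l, q, hq, hpq⟩
  · exact Or.inl (h.mono fun _ => Or.inr)
  by_cases hl : ∀ t, c.toFun n l t ∈ B
  · exact Or.inl (hpq.mono fun r' h' => Or.inl (by rw [h']; exact hl _))
  · exact Or.inr ⟨l, q, hl, hq, hpq⟩

/-- Extension of a map over the `n`-cells. -/
theorem IsCellClosed.exists_extension (hB : c.IsCellClosed B) {n : ℕ} {V : Type*} (u : X → V)
    (v : c.cell n → cube n → V)
    (h : ∀ l (t : cubeBoundary n), v l t.1 = u (c.attachMap n l t)) :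
    ∃ u' : X → V, Set.EqOn u' u (B ∪ c.skel n) ∧
      ∀ l, (¬ ∀ t, c.toFun n l t ∈ B) → ∀ t, u' (c.toFun n l t) = v l t := by
  classical
  -- Cell and coordinate of a new point are chosen, but are unique by `toFun_injective`.
  let u' : X → V := fun x =>
    if h : x ∉ B ∪ c.skel n ∧ ∃ y : c.cell n × cube n, y.2 ∉ cubeBoundary n ∧ x = c.toFun n y.1 y.2
    then v h.2.choose.1 h.2.choose.2 else u x
  have h0 : Set.EqOn u' u (B ∪ c.skel n) := fun x hx => dif_neg fun h => h.1 hx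
  refine ⟨u', h0, fun l hl t => ?_⟩
  by_cases ht : t ∈ cubeBoundary n
  · rw [h0 (Or.inr (c.toFun_mem_skel l ht)), c.toFun_boundary l ⟨t, ht⟩, ← h l ⟨t, ht⟩]
  · have h1 : c.toFun n l t ∉ B ∪ c.skel n := by
      rintro (h' | h')
      · exact hl (hB n l t ht h')
      · exact c.toFun_notMem_skel l ht h'
    have h2 : ∃ y : c.cell n × cube n,
      y.2 ∉ cubeBoundary n ∧ c.toFun n l t = c.toFun n y.1 y.2 := ⟨(l, t), ht, rfl⟩
    have h3 : u' (c.toFun n l t) = v h2.choose.1 h2.choose.2 := dif_pos ⟨h1, h2⟩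
    obtain ⟨e1, e2⟩ := c.toFun_injective h2.choose_spec.1 h2.choose_spec.2
    rw [h3, ← e1, ← e2]

/-- Locally, a plot stays in `B ∪ c.skel n` or factors through one new cell. The parameter space `T`
makes this applicable to homotopies. -/
theorem IsCellClosed.smoothOn_succ (hB : c.IsCellClosed B) {n : ℕ} {T : Type*} {V : Type*}
    [DiffeologicalSpace T] [DiffeologicalSpace V] {u : X × T → V}
    (h : SmoothOn u ((B ∪ c.skel n) ×ˢ Set.univ))
    (h' : ∀ l, (¬ ∀ t, c.toFun n l t ∈ B) →
      DSmooth fun z : cube n × T => u (c.toFun n l z.1, z.2)) :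
    SmoothOn u ((B ∪ c.skel (n + 1)) ×ˢ Set.univ) := by
  intro m p hp hpS
  refine isPlot_of_locally fun r => ?_
  rcases hB.eventually_mem_succ hp.1 (fun r => (hpS r).1) r with hr | ⟨l, q, hl, hq, hpq⟩
  · exact ⟨_, hr, fun k f hf hs => h k _ (isPlot_reparam hp hs) fun x => ⟨hf x, trivial⟩⟩
  · refine ⟨_, hpq, fun k f hf hs => ?_⟩
    have := h' l hl k (fun x => (q (f x), (p (f x)).2))
      ⟨isPlot_reparam hq hs, isPlot_reparam hp.2 hs⟩
    refine (congrArg IsPlot (funext fun x => ?_)).mp this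
    have hx : (p (f x)).1 = c.toFun n l (q (f x)) := hf x
    simp only [Function.comp_apply, ← hx]

end RelCWComplex

end Cells

/-! ### Lifting up to homotopy through maps that are compressible on all cells -/

/-- A tame map on the boundary of the cube only depends on its argument up to moving coordinates
that are close to the ends of the interval. -/
theorem IsTame.exists_near {n : ℕ} {X : Type*} {f : cubeBoundary n → X} (hf : IsTame f) :
    ∃ ε : ℝ, (0 < ε ∧ ε ≤ 1 / 4) ∧
      ∀ s s' : cubeBoundary n, Near ε s.1.1 s'.1.1 → f s = f s' := by
  classical
  obtain ⟨ε₀, hε₀, -, hf⟩ := hf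
  refine ⟨min ε₀ (1 / 4), ⟨lt_min hε₀ (by norm_num), min_le_right _ _⟩, ?_⟩
  set ε := min ε₀ (1 / 4)
  have hε : 0 < ε := lt_min hε₀ (by norm_num)
  have hε4 : ε ≤ 1 / 4 := min_le_right _ _
  -- Tameness changes one coordinate at a time, so the end zones are clamped coordinate by
  -- coordinate. As `cl` fixes `0` and `1`, the point never leaves the boundary.
  let cl : ℝ → ℝ := fun x => if x ≤ ε then 0 else if 1 - ε ≤ x then 1 else x
  have cl0 : cl 0 = 0 := if_pos hε.le
  have cl1 : cl 1 = 1 := by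
    simp only [cl]; rw [if_neg (by linarith), if_pos (by linarith)]
  have hcl : ∀ x ∈ Set.Icc (0 : ℝ) 1, cl x ∈ Set.Icc (0 : ℝ) 1 := by
    intro x hx
    simp only [cl]
    split_ifs
    · simp
    · simp
    · exact hx
  -- `C J` clamps all coordinates in `J`
  let C : Finset (Fin n) → cubeBoundary n → cubeBoundary n := fun J s =>
    ⟨⟨WithLp.toLp 2 fun j => if j ∈ J then cl (s.1.1 j) else s.1.1 j, fun j => by
      change (if j ∈ J then cl (s.1.1 j) else s.1.1 j) ∈ Set.Icc (0 : ℝ) 1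
      split_ifs
      · exact hcl _ (s.1.2 j)
      · exact s.1.2 j⟩, by
      obtain ⟨j, hj⟩ := s.2
      refine ⟨j, ?_⟩
      change (if j ∈ J then cl (s.1.1 j) else s.1.1 j) = 0 ∨
        (if j ∈ J then cl (s.1.1 j) else s.1.1 j) = 1
      rcases hj with hj | hj <;> simp [hj, cl0, cl1]⟩
  have hC : ∀ J s j, (C J s).1.1 j = if j ∈ J then cl (s.1.1 j) else s.1.1 j := fun _ _ _ => rfl
  have key : ∀ J s, f (C J s) = f s := by
    intro J
    induction J using Finset.induction_on with
    | empty =>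
      intro s
      congr 1
    | insert i J hi ih =>
      intro s
      rw [← ih s]
      have hoff : ∀ k, k ≠ i → (C (insert i J) s).1.1 k = (C J s).1.1 k := fun k hk => by
        simp [hC, hk]
      have hJ : (C J s).1.1 i = s.1.1 i := by simp [hC, hi]
      have hI : (C (insert i J) s).1.1 i = cl (s.1.1 i) := by simp [hC]
      have hs := s.1.2 i
      by_cases h1 : s.1.1 i ≤ ε
      · refine (hf _ _ i 0 (Or.inl rfl) ?_ ?_ hoff).symm
        · rw [hJ, sub_zero, abs_of_nonneg hs.1]
          exact h1.trans (min_le_left _ _)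
        · rw [hI]; exact if_pos h1
      · by_cases h2 : 1 - ε ≤ s.1.1 i
        · refine (hf _ _ i 1 (Or.inr rfl) ?_ ?_ hoff).symm
          · rw [hJ, abs_sub_comm, abs_of_nonneg (by linarith [hs.2])]
            exact le_trans (by linarith) (min_le_left ε₀ (1 / 4))
          · rw [hI]; exact (if_neg h1).trans (if_pos h2)
        · congr 1
          ext k
          by_cases hk : k = i
          · subst hk
            rw [hI, hJ]
            exact (if_neg h1).trans (if_neg h2)
          · exact hoff k hk
  intro s s' hs
  rw [← key Finset.univ s, ← key Finset.univ s']
  congr 1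
  ext j
  simp only [hC, Finset.mem_univ, if_true]
  rcases hs j with h | ⟨h, h'⟩ | ⟨h, h'⟩
  · rw [h]
  · simp [cl, h, h']
  · have e : ∀ x, 1 - ε ≤ x → cl x = 1 := fun x hx => by
      simp only [cl]; rw [if_neg (by linarith), if_pos hx]
    rw [e _ h, e _ h']

section Lifting

open RelCWComplex

variable {W : Type u} {X : Type*} {Y : Type*} [DiffeologicalSpace W] [DiffeologicalSpace X]
  [DiffeologicalSpace Y] {c : CWComplex.{u, w} W}

/-- The map `g` lifts `f` through `φ` over the set `S`, up to the homotopy `K`, which is constant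
in time during `[0, δ]` and `[1 - δ, 1]`. -/
structure IsLiftOn (φ : X → Y) (f : W → Y) (S : Set W) (δ : ℝ) (g : W → X)
    (K : W × unitInterval → Y) : Prop where
  smooth_lift : SmoothOn g S
  smooth_homotopy : SmoothOn K (S ×ˢ Set.univ)
  zero : ∀ x ∈ S, K (x, 0) = f x
  one : ∀ x ∈ S, K (x, 1) = φ (g x)
  near : ∀ x ∈ S, ∀ t t' : unitInterval, RNear δ t t' → K (x, t) = K (x, t')

/-- `exists_cell_extension` is applied to each `n`-cell, and its result is used only on cells not
contained in `B`. -/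
theorem IsLiftOn.exists_succ [Nonempty X] (hc : c.IsGathered) {B : Set W} (hB : c.IsCellClosed B)
    {φ : X → Y} {n : ℕ} (hφ : Nonempty (c.cell n) → Compressible n φ)
    {f : W → Y} (hf : DSmooth f) {δ : ℝ} (hδ : 0 < δ ∧ δ ≤ 1 / 4) {g : W → X}
    {K : W × unitInterval → Y} (h : IsLiftOn φ f (B ∪ c.skel n) δ g K) :
    ∃ (g' : W → X) (K' : W × unitInterval → Y),
      IsLiftOn φ f (B ∪ c.skel (n + 1)) (δ / 8) g' K' ∧ Set.EqOn g' g (B ∪ c.skel n) ∧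
      ∀ x ∈ B ∪ c.skel n, ∀ t, K' (x, t) = K (x, t) := by
  have hatt : ∀ l, DSmooth fun s => (c.attachMap n l s : W) := fun l =>
    dSmooth_val.comp ((c.isPushout n).smooth_att l)
  have hmem : ∀ l s, (c.attachMap n l s : W) ∈ B ∪ c.skel n := fun l s =>
    Or.inr (c.attachMap n l s).2
  have key : ∀ l : c.cell n, ∃ (g' : cube n → X) (K' : cube n × unitInterval → Y),
      DSmooth g' ∧ DSmooth K' ∧ (∀ s : cubeBoundary n, g' s.1 = g (c.attachMap n l s)) ∧
      (∀ s, K' (s, 0) = f (c.toFun n l s)) ∧ (∀ s, K' (s, 1) = φ (g' s)) ∧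
      (∀ (s : cubeBoundary n) t, K' (s.1, t) = K (c.attachMap n l s, t)) ∧
      ∀ s (t t' : unitInterval), RNear (δ / 8) t t' → K' (s, t) = K' (s, t') := by
    intro l
    obtain ⟨ε, hε, htame⟩ := (hc n l).exists_near
    refine exists_cell_extension (hφ ⟨l⟩) (f := fun s => f (c.toFun n l s))
      (g := fun s => g (c.attachMap n l s)) (k := fun z => K (c.attachMap n l z.1, z.2))
      (hf.comp (c.dSmooth_toFun l)) (h.smooth_lift.comp_dSmooth (hatt l) (hmem l))
      (h.smooth_homotopy.comp_dSmooth (f := fun z : cubeBoundary n × unitInterval =>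
        ((c.attachMap n l z.1 : W), z.2)) (((hatt l).comp dSmooth_fst).prodMk dSmooth_snd)
        fun z => ⟨hmem l _, trivial⟩)
      hε hδ (fun s s' hs => ?_) (fun s t t' ht => h.near _ (hmem l s) t t' ht)
      (fun s => ?_) fun s => h.one _ (hmem l s)
    · simp [htame s s' hs]
    · rw [h.zero _ (hmem l s), c.toFun_boundary l s]
  choose gl Kl hgl hKl hglb hKl0 hKl1 hKlb hKln using key
  obtain ⟨g', hg'0, hg'l⟩ := hB.exists_extension g gl hglb
  obtain ⟨K', hK'0, hK'l⟩ := hB.exists_extension (V := unitInterval → Y) (fun x t => K (x, t))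
    (fun l s t => Kl l (s, t)) fun l s => funext fun t => hKlb l s t
  have hcases : ∀ x ∈ B ∪ c.skel (n + 1), x ∈ B ∪ c.skel n ∨
      ∃ l, (¬ ∀ t, c.toFun n l t ∈ B) ∧ ∃ s, x = c.toFun n l s := by
    rintro x (hx | hx)
    · exact Or.inl (Or.inl hx)
    rcases c.mem_skel_succ hx with hx | ⟨l, t, -, rfl⟩
    · exact Or.inl (Or.inr hx)
    · by_cases hl : ∀ t, c.toFun n l t ∈ B
      · exact Or.inl (Or.inl (hl t))
      · exact Or.inr ⟨l, hl, t, rfl⟩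
  have e0 : ∀ x ∈ B ∪ c.skel n, ∀ t, K' x t = K (x, t) := fun x hx t => congrFun (hK'0 hx) t
  have el : ∀ l, (¬ ∀ t, c.toFun n l t ∈ B) → ∀ s t, K' (c.toFun n l s) t = Kl l (s, t) :=
    fun l hl s t => congrFun (hK'l l hl s) t
  refine ⟨g', fun z => K' z.1 z.2, ⟨?_, ?_, fun x hx => ?_, fun x hx => ?_, fun x hx t t' ht => ?_⟩,
    hg'0, fun x hx t => e0 x hx t⟩
  · have := hB.smoothOn_succ (T := unitInterval) (u := fun z => g' z.1) (n := n)
      ((h.smooth_lift.congr hg'0).comp (dSmooth_fst.smoothOn _) fun z hz => hz.1)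
      fun l hl => by
        simp only [hg'l l hl]
        exact (hgl l).comp dSmooth_fst
    exact this.comp (f := fun x => (x, (0 : unitInterval))) (DSmooth.smoothOn (by fun_prop) _)
      fun x hx => ⟨hx, trivial⟩
  · refine hB.smoothOn_succ (h.smooth_homotopy.congr fun z hz => e0 _ hz.1 _) fun l hl => ?_
    simp only [el l hl]
    exact hKl l
  · rcases hcases x hx with hx | ⟨l, hl, s, rfl⟩
    · exact (e0 x hx 0).trans (h.zero x hx)
    · exact (el l hl s 0).trans (hKl0 l s)
  · rcases hcases x hx with hx | ⟨l, hl, s, rfl⟩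
    · rw [hg'0 hx]
      exact (e0 x hx 1).trans (h.one x hx)
    · rw [hg'l l hl]
      exact (el l hl s 1).trans (hKl1 l s)
  · rcases hcases x hx with hx | ⟨l, hl, s, rfl⟩
    · have ht' := h.near x hx t t' (ht.mono (by linarith [hδ.1]))
      exact (e0 x hx t).trans (ht'.trans (e0 x hx t').symm)
    · exact (el l hl s t).trans ((hKln l s t t' ht).trans (el l hl s t').symm)

/-- The stages extend one another, so they have a limit. The stationary times `δ / 8 ^ n` tend to
`0`, which is harmless: a plot locally meets only one stage, and the conclusion does not mention
them. -/
theorem IsLiftOn.exists_lift [Nonempty X] (hc : c.IsGathered) {B : Set W} (hB : c.IsCellClosed B)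
    {φ : X → Y} (hφ : ∀ n, Nonempty (c.cell n) → Compressible n φ)
    {f : W → Y} (hf : DSmooth f) {δ : ℝ} (hδ : 0 < δ ∧ δ ≤ 1 / 4) {g : W → X}
    {K : W × unitInterval → Y} (h : IsLiftOn φ f B δ g K) :
    ∃ (g' : W → X) (K' : W × unitInterval → Y), DSmooth g' ∧ DSmooth K' ∧ Set.EqOn g' g B ∧
      (∀ x ∈ B, ∀ t, K' (x, t) = K (x, t)) ∧ (∀ x, K' (x, 0) = f x) ∧
      ∀ x, K' (x, 1) = φ (g' x) := by
  have hδn : ∀ n : ℕ, 0 < δ / 8 ^ n ∧ δ / 8 ^ n ≤ 1 / 4 := fun n =>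
    ⟨div_pos hδ.1 (by positivity),
      (div_le_self hδ.1.le (one_le_pow₀ (by norm_num))).trans hδ.2⟩
  let D : ℕ → Type _ := fun n => {x : (W → X) × (W × unitInterval → Y) //
    IsLiftOn φ f (B ∪ c.skel n) (δ / 8 ^ n) x.1 x.2}
  have step : ∀ n (x : D n), ∃ y : D (n + 1), Set.EqOn y.1.1 x.1.1 (B ∪ c.skel n) ∧
      ∀ z ∈ B ∪ c.skel n, ∀ t, y.1.2 (z, t) = x.1.2 (z, t) := by
    rintro n ⟨⟨g, K⟩, h⟩
    obtain ⟨g', K', h', e, e'⟩ := h.exists_succ hc hB (hφ n) hf (hδn n)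
    refine ⟨⟨(g', K'), ?_⟩, e, e'⟩
    rw [pow_succ, ← div_div]
    exact h'
  choose next hnext hnext' using step
  have h0 : IsLiftOn φ f (B ∪ c.skel 0) (δ / 8 ^ 0) g K := by
    rw [c.skel_zero, Set.union_empty, pow_zero, div_one]
    exact h
  let s : ∀ n, D n := fun n => Nat.rec ⟨(g, K), h0⟩ (fun n x => next n x) n
  have hs : ∀ n, s (n + 1) = next n (s n) := fun _ => rfl
  have hmono : ∀ {n m : ℕ}, n ≤ m → B ∪ c.skel n ⊆ B ∪ c.skel m := fun hnm =>
    Set.union_subset_union_right _ (c.skel_mono hnm)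
  have hsg : ∀ {n m : ℕ}, n ≤ m → ∀ x ∈ B ∪ c.skel n, (s m).1.1 x = (s n).1.1 x ∧
      ∀ t, (s m).1.2 (x, t) = (s n).1.2 (x, t) := by
    intro n m hnm x hx
    induction m, hnm using Nat.le_induction with
    | base => simp
    | succ m hm ih =>
      rw [hs]
      exact ⟨(hnext m _ (hmono hm hx)).trans ih.1,
        fun t => (hnext' m _ x (hmono hm hx) t).trans (ih.2 t)⟩
  choose N hN using c.exists_mem_skel
  have key : ∀ n, ∀ x ∈ B ∪ c.skel n, (s (N x)).1.1 x = (s n).1.1 x ∧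
      ∀ t, (s (N x)).1.2 (x, t) = (s n).1.2 (x, t) := by
    intro n x hx
    rcases le_total n (N x) with h | h
    · exact hsg h x hx
    · have := hsg h x (Or.inr (hN x))
      exact ⟨this.1.symm, fun t => (this.2 t).symm⟩
  refine ⟨fun x => (s (N x)).1.1 x, fun z => (s (N z.1)).1.2 z, ?_, ?_,
    fun x hx => (key 0 x (Or.inl hx)).1, fun x hx t => (key 0 x (Or.inl hx)).2 t,
    fun x => (s (N x)).2.zero x (Or.inr (hN x)), fun x => (s (N x)).2.one x (Or.inr (hN x))⟩
  · refine (smoothOn_of_locally fun m p hp _ r => ?_).dSmooth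
    obtain ⟨n, hn⟩ := c.eventually_mem_skel hp r
    exact ⟨_, (s n).2.smooth_lift.congr fun x hx => (key n x hx).1, hn.mono fun _ => Or.inr⟩
  · refine (smoothOn_of_locally fun m p hp _ r => ?_).dSmooth
    obtain ⟨n, hn⟩ := c.eventually_mem_skel hp.1 r
    exact ⟨_, (s n).2.smooth_homotopy.congr fun z hz => (key n z.1 hz.1).2 z.2,
      hn.mono fun _ h => ⟨Or.inr h, trivial⟩⟩

end Lifting

/-! ### Homotopies of maps of pairs -/

section PairHomotopy

variable {X : Type u} {Y : Type v} {Z : Type w} [DiffeologicalSpace X] [DiffeologicalSpace Y]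
  [DiffeologicalSpace Z] {A : Set X} {B : Set Y} {C : Set Z} {f g h : X → Y}

theorem PairHomotopic.symm (H : PairHomotopic A B f g) : PairHomotopic A B g f := by
  obtain ⟨H, hH, h0, h1, hb⟩ := H
  have hs : DSmooth unitInterval.symm := DSmooth.subtype_mk
    (f := fun t : unitInterval => 1 - (t : ℝ)) (by fun_prop) fun t => (unitInterval.symm t).2
  exact ⟨fun z => H (z.1, unitInterval.symm z.2), by fun_prop, by simp [h1], by simp [h0],
    fun a ha t => hb a ha _⟩

theorem PairHomotopic.trans (H : PairHomotopic A B f g) (H' : PairHomotopic A B g h) :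
    PairHomotopic A B f h := by
  obtain ⟨H, hH, h0, h1, hb⟩ := H
  obtain ⟨H', hH', h0', h1', hb'⟩ := H'
  let K : X × ℝ → Y := concat (fun z => H (z.1, stepI z.2)) (fun z => H' (z.1, stepI z.2))
  have hK : DSmooth K := dSmooth_concat (by fun_prop) (by fun_prop) fun z => by simp [h1, h0']
  refine ⟨fun z => K (z.1, z.2), by fun_prop, fun x => ?_, fun x => ?_, fun a ha t => ?_⟩
  · simpa [h0] using concat_zero (fun z => H (z.1, stepI z.2)) (fun z => H' (z.1, stepI z.2)) x
  · simpa [h1'] using concat_one (fun z => H (z.1, stepI z.2)) (fun z => H' (z.1, stepI z.2)) x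
  · simp only [K, concat]
    split_ifs
    exacts [hb a ha _, hb' a ha _]

theorem PairHomotopic.comp_left {φ : Y → Z} (hφ : DSmooth φ) (hBC : Set.MapsTo φ B C)
    (H : PairHomotopic A B f g) : PairHomotopic A C (φ ∘ f) (φ ∘ g) := by
  obtain ⟨H, hH, h0, h1, hb⟩ := H
  exact ⟨φ ∘ H, hφ.comp hH, fun x => congrArg φ (h0 x), fun x => congrArg φ (h1 x),
    fun a ha t => hBC (hb a ha t)⟩

theorem PairHomotopic.comp_right {φ : Z → X} (hφ : DSmooth φ) (hCA : Set.MapsTo φ C A)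
    (H : PairHomotopic A B f g) : PairHomotopic C B (f ∘ φ) (g ∘ φ) := by
  obtain ⟨H, hH, h0, h1, hb⟩ := H
  exact ⟨fun z => H (φ z.1, z.2), by fun_prop, fun x => h0 _, fun x => h1 _,
    fun a ha t => hb _ (hCA ha) t⟩

theorem PairHomotopic.homotopic (H : PairHomotopic A B f g) : Homotopic f g := by
  obtain ⟨H, hH, h0, h1, -⟩ := H
  exact ⟨H, hH, h0, h1⟩

theorem PairHomotopic.homotopic_restrict {θ : X → X} (hθ : Set.MapsTo θ A A)
    (H : PairHomotopic A A θ id) : Homotopic (hθ.restrict θ A A) id := by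
  obtain ⟨H, hH, h0, h1, hb⟩ := H
  exact ⟨fun z => ⟨H (z.1.1, z.2), hb _ z.1.2 _⟩, DSmooth.subtype_mk (by fun_prop) _,
    fun x => Subtype.ext (h0 _), fun x => Subtype.ext (h1 _)⟩

end PairHomotopy

/-! ### The Whitehead theorem -/

section Whitehead

open RelCWComplex

variable {X : Type u} {Y : Type v} [DiffeologicalSpace X] [DiffeologicalSpace Y]

/-- The map of pairs `φ` and its restriction are equivalences up to dimension `N`. -/
structure IsPairSpheroidEquivalence (N : ℕ) (A : Set X) (B : Set Y) (φ : X → Y)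
    (h : Set.MapsTo φ A B) : Prop where
  total : IsSpheroidEquivalence N φ
  restrict : IsSpheroidEquivalence N (h.restrict φ A B)

theorem smoothOn_empty {f : X → Y} : SmoothOn f ∅ := fun _ _ _ h => (h 0).elim

theorem exists_lift_of_isEmpty [IsEmpty Y] {A : Set X} {B : Set Y} {φ : X → Y} :
    ∃ ψ : Y → X, DSmooth ψ ∧ Set.MapsTo ψ B A ∧ PairHomotopic B B (φ ∘ ψ) id :=
  ⟨isEmptyElim, fun _ p _ => isEmptyElim (p 0), fun y => isEmptyElim y,
    fun z => isEmptyElim z.1, fun _ p _ => isEmptyElim (p 0).1, isEmptyElim, isEmptyElim,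
    fun y => isEmptyElim y⟩

/-- A map that is an equivalence in the dimensions of all cells of `Y` has a right homotopy
inverse. -/
theorem exists_rightInverse {d : CWComplex.{v, w} Y} (hd : d.IsGathered) {φ : X → Y}
    (hφ : ∀ n, Nonempty (d.cell n) → ∃ N, n < N ∧ IsSpheroidEquivalence N φ) {B : Set Y}
    (hB : d.IsCellClosed B) {δ : ℝ} (hδ : 0 < δ ∧ δ ≤ 1 / 4) {g : Y → X}
    {K : Y × unitInterval → Y} (h : IsLiftOn φ id B δ g K) :
    ∃ (ψ : Y → X) (K' : Y × unitInterval → Y), DSmooth ψ ∧ DSmooth K' ∧ Set.EqOn ψ g B ∧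
      (∀ y ∈ B, ∀ t, K' (y, t) = K (y, t)) ∧ (∀ y, K' (y, 0) = y) ∧
      ∀ y, K' (y, 1) = φ (ψ y) := by
  rcases isEmpty_or_nonempty Y with hY | ⟨⟨y⟩⟩
  · exact ⟨isEmptyElim, fun z => isEmptyElim z.1, fun _ p _ => isEmptyElim (p 0),
      fun _ p _ => isEmptyElim (p 0).1, fun y => isEmptyElim y, fun y => isEmptyElim y,
      fun y => isEmptyElim y, fun y => isEmptyElim y⟩
  · have : Nonempty X := ⟨g y⟩
    exact h.exists_lift hd hB (fun n hn => by
      obtain ⟨N, hN, h⟩ := hφ n hn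
      exact h.compressible hN) dSmooth_id hδ

/-- A nonempty complex has a `0`-cell, which guarantees an equivalence of some positive order; its
path condition then yields a point of `X`. -/
theorem nonempty_of_equivalence {d : CWComplex.{v, w} Y} {φ : X → Y}
    (hφ : ∀ n, Nonempty (d.cell n) → ∃ N, n < N ∧ IsSpheroidEquivalence N φ) (y : Y) :
    Nonempty X := by
  have : Nonempty Y := ⟨y⟩
  obtain ⟨N, hN, h⟩ := hφ 0 d.nonempty_cell_zero
  exact ⟨(h.joined hN y).choose⟩

/-- Lift the identity of `B` through `A → B`, starting from the empty set, and extend this lift and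
homotopy over `Y`. The extended homotopy stays in `B` over `B`, so it is one of pairs. -/
theorem exists_pair_rightInverse {d : CWComplex.{v, w} Y} (hd : d.IsGathered) {A : Set X}
    {B : Set Y} (hB : d.IsSubcomplex B) {φ : X → Y} (hAB : Set.MapsTo φ A B)
    (hφ : ∀ n, Nonempty (d.cell n) → ∃ N, n < N ∧ IsPairSpheroidEquivalence N A B φ hAB) :
    ∃ ψ : Y → X, DSmooth ψ ∧ Set.MapsTo ψ B A ∧ PairHomotopic B B (φ ∘ ψ) id := by
  classical
  rcases isEmpty_or_nonempty Y with hY | ⟨⟨y⟩⟩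
  · exact exists_lift_of_isEmpty
  obtain ⟨x⟩ : Nonempty X := nonempty_of_equivalence (fun n hn => (hφ n hn).imp fun N h =>
    ⟨h.1, h.2.total⟩) y
  have hBc := hB.isCellClosed
  obtain ⟨b, hb⟩ := hB
  have hbg : b.IsGathered := by
    intro n l
    obtain ⟨l', hl'⟩ := hb n l
    obtain ⟨ε, hε, hε', h⟩ := hd n l'
    have e : ∀ s : cubeBoundary n, ((b.attachMap n l s : B) : Y) = d.attachMap n l' s := fun s => by
      rw [← b.toFun_boundary, ← d.toFun_boundary]
      exact hl' s.1
    refine ⟨ε, hε, hε', fun s t j α hα h1 h2 h3 => Subtype.ext (Subtype.ext ?_)⟩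
    rw [e, e, h s t j α hα h1 h2 h3]
  have hφb : ∀ n, Nonempty (b.cell n) → ∃ N, n < N ∧
      IsSpheroidEquivalence N (hAB.restrict φ A B) := fun n ⟨l⟩ => by
    obtain ⟨N, hN, h⟩ := hφ n ⟨(hb n l).choose⟩
    exact ⟨N, hN, h.restrict⟩
  have hinit : ∃ (g : B → A) (K : B × unitInterval → B),
      IsLiftOn (hAB.restrict φ A B) id ∅ (1 / 4) g K := by
    have hBA : B → A := fun y => Classical.choice (nonempty_of_equivalence hφb y)
    exact ⟨hBA, Prod.fst, smoothOn_empty, by rw [Set.empty_prod]; exact smoothOn_empty,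
      fun _ h => h.elim, fun _ h => h.elim, fun _ h => h.elim⟩
  obtain ⟨g, K, h⟩ := hinit
  obtain ⟨ψ₀, K₀, hψ₀, hK₀, -, -, hK0, hK1⟩ :=
    exists_rightInverse hbg hφb b.isCellClosed_empty quarter h
  let g₁ : Y → X := fun y => if h : y ∈ B then ψ₀ ⟨y, h⟩ else x
  -- Flattening time makes the homotopy stationary near both ends, as an initial `IsLiftOn`
  -- requires.
  let K₁ : Y × unitInterval → Y := fun z =>
    if h : z.1 ∈ B then K₀ (⟨z.1, h⟩, flattenI quarter z.2) else z.1
  have hg₁ : ∀ y (h : y ∈ B), g₁ y = ψ₀ ⟨y, h⟩ := fun y h => dif_pos h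
  have hK₁ : ∀ y (h : y ∈ B) t, K₁ (y, t) = K₀ (⟨y, h⟩, flattenI quarter t) :=
    fun y h t => dif_pos h
  have fl0 : flattenI quarter ((0 : unitInterval) : ℝ) = 0 :=
    Subtype.ext (flatten_zero quarter.1 quarter.2)
  have fl1 : flattenI quarter ((1 : unitInterval) : ℝ) = 1 := Subtype.ext (flatten_one quarter.1)
  have hlift : IsLiftOn φ id B (1 / 4 / 2) g₁ K₁ := by
    refine ⟨smoothOn_of_subtype ?_, smoothOn_of_subtype ?_, fun y hy => ?_, fun y hy => ?_,
      fun y hy t t' ht => ?_⟩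
    · rw [show (fun y : B => g₁ y) = fun y => (ψ₀ y : X) from funext fun y => hg₁ y y.2]
      fun_prop
    · rw [show (fun z : (B ×ˢ Set.univ : Set (Y × unitInterval)) => K₁ z) =
        fun z => (K₀ (⟨z.1.1, z.2.1⟩, flattenI quarter z.1.2) : Y) from
          funext fun z => hK₁ _ z.2.1 _]
      refine dSmooth_val.comp (hK₀.comp (DSmooth.prodMk (DSmooth.subtype_mk ?_ _) ?_)) <;> fun_prop
    · rw [hK₁ y hy, fl0, hK0]
      rfl
    · rw [hK₁ y hy, fl1, hK1, hg₁ y hy]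
      rfl
    · rw [hK₁ y hy, hK₁ y hy, flattenI, flattenI]
      simp only [flatten_eq_of_near quarter.1 quarter.2 ht]
  obtain ⟨ψ, K', hψ, hK', hψg, hK'K, hK'0, hK'1⟩ := exists_rightInverse hd
    (fun n hn => (hφ n hn).imp fun N h => ⟨h.1, h.2.total⟩) hBc (by norm_num) hlift
  refine ⟨ψ, hψ, fun y hy => ?_, PairHomotopic.symm ⟨K', hK', hK'0, hK'1, fun y hy t => ?_⟩⟩
  · rw [hψg hy, hg₁ y hy]
    exact Subtype.coe_prop _
  · rw [hK'K y hy, hK₁ y hy]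
    exact Subtype.coe_prop _

/-- The set `𝒩` treats both cases at once: a single `N` above all cell dimensions, or all natural
numbers. -/
theorem isPairHomotopyEquiv_of_equivalence {c : CWComplex.{u, w} X} {d : CWComplex.{v, w'} Y}
    (hc : c.IsGathered) (hd : d.IsGathered) {A : Set X} {B : Set Y} (hA : c.IsSubcomplex A)
    (hB : d.IsSubcomplex B) {φ : X → Y} {𝒩 : Set ℕ} (h𝒩 : 𝒩.Nonempty)
    (hc𝒩 : ∀ n, Nonempty (c.cell n) → ∃ N ∈ 𝒩, n < N)
    (hd𝒩 : ∀ n, Nonempty (d.cell n) → ∃ N ∈ 𝒩, n < N)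
    (hφ : ∀ N ∈ 𝒩, IsPairNEquivalence N A B φ) : IsPairHomotopyEquiv A B φ := by
  obtain ⟨N₀, hN₀⟩ := h𝒩
  obtain ⟨hAB, ⟨hφs, -⟩, -⟩ := hφ N₀ hN₀
  have hφ' : ∀ N ∈ 𝒩, IsPairSpheroidEquivalence N A B φ hAB := fun N hN => by
    obtain ⟨_, h, h'⟩ := hφ N hN
    exact ⟨h.isSpheroidEquivalence, h'.isSpheroidEquivalence⟩
  obtain ⟨ψ, hψ, hBA, H⟩ := exists_pair_rightInverse hd hB hAB fun n hn => by
    obtain ⟨N, hN, hnN⟩ := hd𝒩 n hn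
    exact ⟨N, hnN, hφ' N hN⟩
  have hψ' : ∀ N ∈ 𝒩, IsPairSpheroidEquivalence N B A ψ hBA := fun N hN =>
    ⟨(hφ' N hN).total.of_rightInverse hψ H.homotopic,
      (hφ' N hN).restrict.of_rightInverse
        (DSmooth.subtype_mk (f := fun y : B => ψ y) (by fun_prop) fun y => hBA y.2)
        (H.homotopic_restrict (hAB.comp hBA))⟩
  obtain ⟨χ, hχ, hAB', H'⟩ := exists_pair_rightInverse hc hA hBA fun n hn => by
    obtain ⟨N, hN, hnN⟩ := hc𝒩 n hn
    exact ⟨N, hnN, hψ' N hN⟩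
  -- `φ ≃ φ ∘ (ψ ∘ χ) = (φ ∘ ψ) ∘ χ ≃ χ`.
  have h1 : PairHomotopic A B φ χ :=
    (H'.comp_left hφs hAB).symm.trans (H.comp_right hχ hAB')
  exact ⟨hφs, hAB, ψ, hψ, hBA, (h1.comp_left hψ hBA).trans H', H⟩

/-- The empty complex. -/
def emptyComplex (X : Type u) [DiffeologicalSpace X] : CWComplex.{u, w} (∅ : Set X) where
  skel _ := ∅
  skel_zero := rfl
  skel_subset _ := le_rfl
  cell _ := PEmpty
  attachMap _ l := l.elim
  charMap _ l := l.elim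
  isPushout _ :=
    { smooth_att := fun l => l.elim
      surjective := fun x => x.2.elim
      eq_iff := fun a => a.elim (fun x => x.2.elim) fun x => x.1.elim
      isPlot_iff := fun p => (p 0).2.elim }
  iUnion_skel := Set.ext fun x => x.2.elim
  isPlot_iff p := (p 0).2.elim

theorem isSubcomplex_empty (c : CWComplex.{u, w} X) : c.IsSubcomplex ∅ :=
  ⟨emptyComplex X, fun _ l => l.elim⟩

theorem IsNEquivalence.isPairNEquivalence_empty {N : ℕ} {φ : X → Y} (h : IsNEquivalence N φ) :
    IsPairNEquivalence N ∅ ∅ φ :=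
  ⟨fun _ h => h.elim, h, fun _ p _ => (p 0).2.elim, fun _ y => y.2.elim, fun x => x.2.elim⟩

end Whitehead

end SmoothCW

theorem mainTheorem2 {X : Type u} {Y : Type v} [DiffeologicalSpace X] [DiffeologicalSpace Y]
    (c : SmoothCW.CWComplex.{u, w} X) (d : SmoothCW.CWComplex.{v, w'} Y)
    (hc : c.IsGathered) (hd : d.IsGathered) (φ : X → Y) :
    (∀ (A : Set X) (B : Set Y), c.IsSubcomplex A → d.IsSubcomplex B →
      ∀ N : ℕ, c.DimLT N → d.DimLT N →
        SmoothCW.IsPairNEquivalence N A B φ → SmoothCW.IsPairHomotopyEquiv A B φ) ∧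
    (∀ (A : Set X) (B : Set Y), c.IsSubcomplex A → d.IsSubcomplex B →
      SmoothCW.IsPairWeakEquiv A B φ → SmoothCW.IsPairHomotopyEquiv A B φ) ∧
    (SmoothCW.IsWeakEquiv φ → SmoothCW.IsHomotopyEquiv φ) := by
  have weak : ∀ (A : Set X) (B : Set Y), c.IsSubcomplex A → d.IsSubcomplex B →
      SmoothCW.IsPairWeakEquiv A B φ → SmoothCW.IsPairHomotopyEquiv A B φ := fun A B hA hB h =>
    SmoothCW.isPairHomotopyEquiv_of_equivalence hc hd hA hB Set.univ_nonempty
      (fun n _ => ⟨n + 1, trivial, n.lt_succ_self⟩) (fun n _ => ⟨n + 1, trivial, n.lt_succ_self⟩)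
      fun N _ => h N
  refine ⟨fun A B hA hB N hcN hdN h => ?_, weak, fun h => ?_⟩
  · exact SmoothCW.isPairHomotopyEquiv_of_equivalence hc hd hA hB (Set.singleton_nonempty N)
      (fun n hn => ⟨N, rfl, c.lt_of_dimLT hcN hn⟩) (fun n hn => ⟨N, rfl, d.lt_of_dimLT hdN hn⟩)
      fun _ hN => hN ▸ h
  · obtain ⟨hφ, -, ψ, hψ, -, h1, h2⟩ := weak ∅ ∅ (SmoothCW.isSubcomplex_empty c)
      (SmoothCW.isSubcomplex_empty d) fun N => (h N).isPairNEquivalence_empty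
    exact ⟨hφ, ψ, hψ, h1.homotopic, h2.homotopic⟩
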